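/- Let $\mathbb K=\mathbb R$ or $\mathbb C$. A \emph{$k$-space} is a topological space in which a set is open as soon as its preimage under every continuous map from a compact Hausdorff space is open; $kX$ is $X$ retopologised by the sets satisfying this condition. An \emph{$hk$-space} is a $k$-space $X$ whose diagonal is closed in $k(X\times X)$; $hk\mathsf{Top}$ is the category of $hk$-spaces and continuous maps, and $\mathsf{Pol}\subseteq hk\mathsf{Top}$ the full subcategory of Polish spaces. $Y^X$ denotes the $k$-ification of the space of continuous maps $X\to Y$ with the compact-open topology, and $V^\wedge\subseteq\mathbb K^V$ the subspace of continuous linear functionals. For an $hk$-space $X$, let $C_b(X)=\operatorname{colim}_n (nD)^X$, where $D\subseteq\mathbb K$ is the closed unit disc (as a set, this is the set of bounded continuous functions $X\to\mathbb K$), let $\mathcal M(X)\subseteq C_b(X)^\wedge$ be the closed linear span of the point evaluations $\delta_x$, and let $\mathcal P(X)\subseteq \mathcal M(X)$ be the subspace of positive functionals $\varphi$ with $\varphi(1)=1$. With pushforward $(g_*\varphi)(f)=\varphi(f\circ g)$, unit $x\mapsto\delta_x$ and multiplication $(\smallint\pi)(f)=\pi(\varphi\mapsto\varphi(f))$, $\mathcal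 P$ is a monad on $hk\mathsf{Top}$. A measure means a countably additive $\mathbb K$-valued measure of bounded variation. A Baire measure is a measure on the $\sigma$-algebra generated by the continuous functions; a Radon measure is a Borel measure $\mu$ such that for every $\varepsilon>0$ there is a compact $K$ with $|\mu|(X\setminus K)<\varepsilon$; a Baire measure $\mu$ is $k$-regular if $f\mapsto\int f\,d\mu$ is continuous on $C_b(X)$ and belongs to $\mathcal M(X)$. \textbf{Proposition.} (1) Let $X$ be a Polish space. The Baire and Borel $\sigma$-algebras of $X$ coincide, every Borel measure on $X$ is a Radon measure, and every Baire measure on $X$ is $k$-regular; hence the notions of Baire, Radon and $k$-regular measure coincide. There is a homeomorphism from $\mathcal P(X)$ onto the space of Borel probability measures on $X$ with the topology of weak convergence, sending $\varphi$ to the measure $\mu$ with $\varphi(f)=\int f\,d\mu$ for all $f\in C_b(X)$. The space $\mathcal P(X)$ is again Polish. (2) The monad $\mathcal P$ restricts to a monad on $\mathsf{Pol}$, and this restriction is isomorphic, through the homeomorphisms in (1), to the Giry monad, that is, the monad which sends a Polish space $X$ to the (Polish) space of Borel probability measures on $X$ with the topology of weak convergence, with pushforward of measures, unit $x\mapsto\delta_x$,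 and multiplication $\mathbb E(\pi)(A)=\int \mu(A)\,d\pi(\mu)$. -/

import Mathlib

open CategoryTheory MeasureTheory Topology
open scoped BoundedContinuousFunction ComplexOrder

universe u

noncomputable section

/-! ### k-spaces, hk-spaces and mapping spaces -/

/-- A set is k-open if its preimage under every continuous map from a compact Hausdorff space is
open. -/
def IsKOpen {X : Type u} [TopologicalSpace X] (U : Set X) : Prop :=
  ∀ (K : Type u) [TopologicalSpace K] [CompactSpace K] [T2Space K] (p : C(K, X)), IsOpen (p ⁻¹' U)

/-- A k-space is a space all of whose k-open sets are open. -/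
def IsKSpace (X : Type u) [TopologicalSpace X] : Prop :=
  ∀ U : Set X, IsKOpen U → IsOpen U

/-- The k-ification of a space: the same points, with the k-open sets as open sets. -/
def Kify (X : Type u) : Type u := X

/-- A point of `X`, seen in the k-ification. -/
def Kify.mk {X : Type u} (x : X) : Kify X := x

/-- A point of the k-ification, seen in `X`. -/
def Kify.val {X : Type u} (x : Kify X) : X := x

instance (X : Type u) [TopologicalSpace X] : TopologicalSpace (Kify X) where
  IsOpen U := IsKOpen (X := X) (Kify.mk ⁻¹' U)
  isOpen_univ := fun _ _ _ _ _ => isOpen_univ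
  isOpen_inter := fun _ _ hs ht K _ _ _ p => (hs K p).inter (ht K p)
  isOpen_sUnion := fun s hs K _ _ _ p => by
    rw [Set.preimage_sUnion, Set.preimage_iUnion₂]
    exact isOpen_biUnion fun t ht => hs t ht K p

/-- An hk-space is a k-space whose diagonal is closed in the product formed in k-spaces, that is, in
the k-ification of the usual product. -/
structure IsHKSpace (X : Type u) [TopologicalSpace X] : Prop where
  isKSpace : IsKSpace X
  isKHausdorff : IsClosed (X := Kify (X × X)) (Set.diagonal X)

/-- Continuous maps with the compact-open topology, generated by the sets
`{f | f (i K) ⊆ U}` for `i : K → X` continuous, `K` compact Hausdorff and `U` open. -/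
def CO (X : Type u) (Y : Type) [TopologicalSpace X] [TopologicalSpace Y] : Type u := C(X, Y)

/-- A continuous map, seen in the space with the compact-open topology. -/
def CO.mk {X : Type u} {Y : Type} [TopologicalSpace X] [TopologicalSpace Y] (f : C(X, Y)) :
    CO X Y := f

/-- The continuous map underlying a point of the space with the compact-open topology. -/
def CO.val {X : Type u} {Y : Type} [TopologicalSpace X] [TopologicalSpace Y] (f : CO X Y) :
    C(X, Y) := f

instance (X : Type u) (Y : Type) [TopologicalSpace X] [TopologicalSpace Y] :
    TopologicalSpace (CO X Y) :=
  TopologicalSpace.generateFrom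
    {W : Set (CO X Y) | ∃ (K : Type u) (_ : TopologicalSpace K) (_ : CompactSpace K) (_ : T2Space K)
      (i : C(K, X)) (U : Set Y), IsOpen U ∧ W = {f | ∀ k, f.val (i k) ∈ U}}

/-- The mapping space `Y ^ X` of k-spaces: the k-ification of the compact-open topology. -/
abbrev KMap (X : Type u) (Y : Type) [TopologicalSpace X] [TopologicalSpace Y] : Type u :=
  Kify (CO X Y)

/-- A continuous map, seen as a point of the mapping space. -/
abbrev KMap.mk {X : Type u} {Y : Type} [TopologicalSpace X] [TopologicalSpace Y] (f : C(X, Y)) :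
    KMap X Y := Kify.mk (CO.mk f)

/-- The continuous map underlying a point of the mapping space. -/
abbrev KMap.toMap {X : Type u} {Y : Type} [TopologicalSpace X] [TopologicalSpace Y]
    (f : KMap X Y) : C(X, Y) := CO.val (Kify.val f)

section MappingSpaces

variable {X : Type u} {Y : Type} [TopologicalSpace X] [TopologicalSpace Y]

theorem Kify.continuous_val : Continuous (Kify.val : Kify X → X) :=
  ⟨fun _ hU _ _ _ _ p => hU.preimage p.continuous⟩

theorem Kify.continuous_of_compact {K : Type u} [TopologicalSpace K] [CompactSpace K] [T2Space K]
    {p : K → X} (hp : Continuous p) : Continuous (fun k => Kify.mk (p k)) :=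
  ⟨fun _ hU => hU K ⟨p, hp⟩⟩

theorem IsKSpace.continuous (hX : IsKSpace X) {Z : Type*} [TopologicalSpace Z] {g : X → Z}
    (hg : ∀ (K : Type u) [TopologicalSpace K] [CompactSpace K] [T2Space K] (p : C(K, X)),
      Continuous (fun k => g (p k))) : Continuous g :=
  ⟨fun _ hU => hX _ fun K _ _ _ p => hU.preimage (hg K p)⟩

theorem Kify.isKSpace (X : Type u) [TopologicalSpace X] : IsKSpace (Kify X) :=
  fun _ hU K _ _ _ p => hU K ⟨fun k => Kify.mk (p k), Kify.continuous_of_compact p.continuous⟩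

theorem Kify.continuous_map {Z : Type u} [TopologicalSpace Z] {g : X → Z}
    (hg : ∀ (K : Type u) [TopologicalSpace K] [CompactSpace K] [T2Space K] (p : C(K, X)),
      Continuous (fun k => g (p k))) : Continuous (fun x : Kify X => Kify.mk (g x.val)) :=
  (Kify.isKSpace X).continuous fun K _ _ _ p =>
    Kify.continuous_of_compact (hg K ⟨fun k => (p k).val, Kify.continuous_val.comp p.continuous⟩)

theorem CO.continuous_of {Z : Type*} [TopologicalSpace Z] {g : Z → C(X, Y)}
    (hg : ∀ (L : Type u) [TopologicalSpace L] [CompactSpace L] [T2Space L] (i : C(L, X)),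
      Continuous fun z => (g z).comp i) : Continuous (fun z => CO.mk (g z)) := by
  refine continuous_generateFrom_iff.2 ?_
  rintro _ ⟨L, _, _, _, i, U, hU, rfl⟩
  have h := (ContinuousMap.isOpen_setOfPred_mapsTo (X := L) isCompact_univ hU).preimage (hg L i)
  convert h using 1
  ext z
  simp only [Set.mem_preimage, Set.mem_ofPred_eq, Set.MapsTo, Set.mem_univ, forall_const]
  rfl

theorem CO.continuous_comp {L : Type u} [TopologicalSpace L] [CompactSpace L] [T2Space L]
    (i : C(L, X)) : Continuous fun f : CO X Y => f.val.comp i := by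
  refine ContinuousMap.continuous_compactOpen.2 fun S hS U hU => ?_
  have : CompactSpace S := isCompact_iff_compactSpace.1 hS
  refine TopologicalSpace.isOpen_generateFrom_of_mem
    ⟨S, inferInstance, inferInstance, inferInstance, i.comp ⟨Subtype.val, continuous_subtype_val⟩,
      U, hU, ?_⟩
  ext f
  simp [Set.MapsTo]

theorem KMap.continuous_comp {L : Type u} [TopologicalSpace L] [CompactSpace L] [T2Space L]
    (i : C(L, X)) : Continuous fun f : KMap X Y => f.toMap.comp i :=
  (CO.continuous_comp i).comp Kify.continuous_val

theorem KMap.continuous_eval (x : X) : Continuous fun f : KMap X Y => f.toMap x :=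
  (continuous_eval_const PUnit.unit).comp
    (KMap.continuous_comp (Y := Y) (ContinuousMap.const PUnit.{u + 1} x))

/-- Continuity of a map between mapping spaces, tested on compact Hausdorff spaces. -/
theorem KMap.continuous_map {X' : Type u} {Y' : Type} [TopologicalSpace X'] [TopologicalSpace Y']
    {g : C(X, Y) → C(X', Y')}
    (hg : ∀ (K : Type u) [TopologicalSpace K] [CompactSpace K] [T2Space K] (p : C(K, CO X Y))
      (L : Type u) [TopologicalSpace L] [CompactSpace L] [T2Space L] (i : C(L, X')),
      Continuous fun k => (g (p k).val).comp i) :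
    Continuous (fun f : KMap X Y => KMap.mk (g f.toMap)) :=
  Kify.continuous_map (g := fun f : CO X Y => CO.mk (g f.val))
    fun K _ _ _ p => CO.continuous_of fun L _ _ _ i => hg K p L i

theorem IsKSpace.of_isClosedEmbedding {Z : Type u} [TopologicalSpace Z] (hX : IsKSpace X)
    {j : Z → X} (hj : IsClosedEmbedding j) : IsKSpace Z := by
  intro U hU
  rw [← isClosed_compl_iff, hj.isClosed_iff_image_isClosed, ← isOpen_compl_iff]
  refine hX _ fun K _ _ _ p => ?_
  set S : Set K := p ⁻¹' Set.range j with hS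
  have hSc : IsClosed S := hj.isClosed_range.preimage p.continuous
  have : CompactSpace S := isCompact_iff_compactSpace.1 hSc.isCompact
  have hq : ∀ s : S, ∃ z, j z = p s := fun s => s.2
  choose q hq using hq
  have hqc : Continuous q := hj.isInducing.continuous_iff.2 (by
    have : j ∘ q = fun s : S => p s := funext hq
    rw [this]; exact p.continuous.comp continuous_subtype_val)
  have h1 := (hU S ⟨q, hqc⟩).isClosed_compl
  have h2 := hSc.isClosedMap_subtype_val _ h1
  have h3 : p ⁻¹' (j '' Uᶜ)ᶜ = (Subtype.val '' ((⇑(⟨q, hqc⟩ : C(S, Z)) ⁻¹' U)ᶜ))ᶜ := by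
    ext k
    simp only [Set.mem_preimage, Set.mem_compl_iff, Set.mem_image, not_iff_not, Subtype.exists]
    constructor
    · rintro ⟨z, hz, hzk⟩
      refine ⟨k, ⟨z, hzk⟩, ?_, rfl⟩
      have : q ⟨k, ⟨z, hzk⟩⟩ = z := hj.injective ((hq _).trans hzk.symm)
      simpa [this] using hz
    · rintro ⟨k', hk', h, rfl⟩
      exact ⟨q ⟨k', hk'⟩, h, hq _⟩
  rw [h3]
  exact h2.isOpen_compl

theorem IsHKSpace.of_t2 [T2Space X] (hX : IsKSpace X) : IsHKSpace X :=
  ⟨hX, isClosed_diagonal.preimage Kify.continuous_val⟩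

theorem IsHKSpace.of_polishSpace [PolishSpace X] : IsHKSpace X := by
  refine .of_t2 fun U hU => ?_
  rw [← isClosed_compl_iff]
  refine IsSeqClosed.isClosed fun x a hx ha hU' => ?_
  let p : C(ULift.{u} (OnePoint ℕ), X) :=
    ⟨fun n => OnePoint.continuousMapMkNat x a ha n.down,
      (OnePoint.continuousMapMkNat x a ha).continuous.comp continuous_uliftDown⟩
  have h := (hU _ p).preimage (continuous_uliftUp (X := OnePoint ℕ))
  have hn := (OnePoint.tendsto_coe_infty (X := ℕ)).eventually (h.mem_nhds (x := OnePoint.infty) hU')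
  obtain ⟨n, hn⟩ := hn.exists
  exact hx n hn

end MappingSpaces

/-! ### Natural duals and bounded continuous functions -/

section Functionals

variable (𝕜 : Type) [RCLike 𝕜]

/-- The natural dual of `V`: the continuous linear functionals, topologised as a subspace of the
mapping space `𝕜 ^ V`. -/
def NatDual (V : Type u) [AddCommGroup V] [Module 𝕜 V] [TopologicalSpace V] : Type u := V →L[𝕜] 𝕜

section NatDual

variable {V W : Type u} [AddCommGroup V] [Module 𝕜 V] [TopologicalSpace V]
  [AddCommGroup W] [Module 𝕜 W] [TopologicalSpace W]

instance : AddCommGroup (NatDual 𝕜 V) := inferInstanceAs (AddCommGroup (V →L[𝕜] 𝕜))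

instance : Module 𝕜 (NatDual 𝕜 V) := inferInstanceAs (Module 𝕜 (V →L[𝕜] 𝕜))

instance : FunLike (NatDual 𝕜 V) V 𝕜 := inferInstanceAs (FunLike (V →L[𝕜] 𝕜) V 𝕜)

instance : ContinuousLinearMapClass (NatDual 𝕜 V) 𝕜 V 𝕜 :=
  inferInstanceAs (ContinuousLinearMapClass (V →L[𝕜] 𝕜) 𝕜 V 𝕜)

variable {𝕜}

/-- The inclusion of the natural dual into the mapping space. -/
def NatDual.toKMap (φ : NatDual 𝕜 V) : KMap V 𝕜 := KMap.mk ⟨φ, map_continuous φ⟩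

instance : TopologicalSpace (NatDual 𝕜 V) := TopologicalSpace.induced NatDual.toKMap inferInstance

@[ext] theorem NatDual.ext {φ ψ : NatDual 𝕜 V} (h : ∀ v, φ v = ψ v) : φ = ψ := DFunLike.ext _ _ h

@[simp] theorem NatDual.add_apply (φ ψ : NatDual 𝕜 V) (v : V) : (φ + ψ) v = φ v + ψ v := rfl

@[simp] theorem NatDual.smul_apply (c : 𝕜) (φ : NatDual 𝕜 V) (v : V) : (c • φ) v = c * φ v := rfl

theorem NatDual.continuous_toKMap : Continuous (NatDual.toKMap : NatDual 𝕜 V → KMap V 𝕜) :=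
  continuous_induced_dom

theorem NatDual.continuous_eval (v : V) : Continuous fun φ : NatDual 𝕜 V => φ v :=
  (KMap.continuous_eval v).comp NatDual.continuous_toKMap

theorem NatDual.continuous_add_right (ψ : NatDual 𝕜 V) :
    Continuous fun φ : NatDual 𝕜 V => φ + ψ := by
  refine continuous_induced_rng.2 ?_
  have h : Continuous fun f : KMap V 𝕜 =>
      KMap.mk (f.toMap + (⟨ψ, map_continuous ψ⟩ : C(V, 𝕜))) := by
    refine KMap.continuous_map (g := fun f => f + (⟨ψ, map_continuous ψ⟩ : C(V, 𝕜))) ?_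
    intro K _ _ _ p L _ _ _ i
    exact ((CO.continuous_comp i).comp p.continuous).add
      (continuous_const (y := ContinuousMap.comp ⟨ψ, map_continuous ψ⟩ i))
  exact h.comp NatDual.continuous_toKMap

theorem NatDual.continuous_const_smul (c : 𝕜) : Continuous fun φ : NatDual 𝕜 V => c • φ := by
  refine continuous_induced_rng.2 ?_
  have h : Continuous fun f : KMap V 𝕜 => KMap.mk (c • f.toMap) := by
    refine KMap.continuous_map (g := fun f => c • f) ?_
    intro K _ _ _ p L _ _ _ i
    exact ((CO.continuous_comp i).comp p.continuous).const_smul c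
  exact h.comp NatDual.continuous_toKMap

/-- The adjoint of a continuous linear map. -/
def NatDual.adjoint (T : V →L[𝕜] W) (φ : NatDual 𝕜 W) : NatDual 𝕜 V :=
  ContinuousLinearMap.comp (show W →L[𝕜] 𝕜 from φ) T

@[simp] theorem NatDual.adjoint_apply (T : V →L[𝕜] W) (φ : NatDual 𝕜 W) (v : V) :
    NatDual.adjoint T φ v = φ (T v) := rfl

theorem NatDual.continuous_adjoint (T : V →L[𝕜] W) :
    Continuous (NatDual.adjoint T : NatDual 𝕜 W → NatDual 𝕜 V) := by
  refine continuous_induced_rng.2 ?_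
  have h : Continuous fun f : KMap W 𝕜 =>
      KMap.mk (f.toMap.comp (⟨T, T.continuous⟩ : C(V, W))) := by
    refine KMap.continuous_map (g := fun f => f.comp (⟨T, T.continuous⟩ : C(V, W))) ?_
    intro K _ _ _ p L _ _ _ i
    exact (CO.continuous_comp ((⟨T, T.continuous⟩ : C(V, W)).comp i)).comp p.continuous
  exact h.comp NatDual.continuous_toKMap

theorem NatDual.isClosedEmbedding_toKMap :
    IsClosedEmbedding (NatDual.toKMap : NatDual 𝕜 V → KMap V 𝕜) := by
  refine ⟨⟨⟨rfl⟩, fun φ ψ h => NatDual.ext fun v => congrArg (fun f => KMap.toMap f v) h⟩, ?_⟩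
  have h : Set.range (NatDual.toKMap : NatDual 𝕜 V → KMap V 𝕜) =
      (⋂ (v : V) (w : V), {f | f.toMap (v + w) = f.toMap v + f.toMap w}) ∩
        ⋂ (c : 𝕜) (v : V), {f | f.toMap (c • v) = c * f.toMap v} := by
    ext f
    simp only [Set.mem_range, Set.mem_inter_iff, Set.mem_iInter, Set.mem_ofPred_eq]
    constructor
    · rintro ⟨φ, rfl⟩
      exact ⟨fun v w => map_add φ v w, fun c v => map_smul φ c v⟩
    · rintro ⟨h1, h2⟩
      exact ⟨(⟨⟨⟨f.toMap, h1⟩, h2⟩, f.toMap.continuous⟩ : V →L[𝕜] 𝕜), rfl⟩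
  rw [h]
  refine IsClosed.inter ?_ ?_
  · exact isClosed_iInter fun v => isClosed_iInter fun w => isClosed_eq (KMap.continuous_eval _)
      ((KMap.continuous_eval _).add (KMap.continuous_eval _))
  · exact isClosed_iInter fun c => isClosed_iInter fun v => isClosed_eq (KMap.continuous_eval _)
      (continuous_const.mul (KMap.continuous_eval _))

end NatDual

variable (X : Type u) [TopologicalSpace X]

/-- Bounded continuous functions, carrying the topology of the colimit of the mapping spaces
`(nD) ^ X`, where `nD` is the closed disc of radius `n`. This colimit of spaces maps continuously
and injectively to the product `𝕜 ^ X`, so that it is Hausdorff and also the colimit in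
hk-spaces. -/
def Cb : Type u := X →ᵇ 𝕜

instance : AddCommGroup (Cb 𝕜 X) := inferInstanceAs (AddCommGroup (X →ᵇ 𝕜))

instance : Module 𝕜 (Cb 𝕜 X) := inferInstanceAs (Module 𝕜 (X →ᵇ 𝕜))

instance : One (Cb 𝕜 X) := inferInstanceAs (One (X →ᵇ 𝕜))

instance : FunLike (Cb 𝕜 X) X 𝕜 := inferInstanceAs (FunLike (X →ᵇ 𝕜) X 𝕜)

variable {𝕜 X}

/-- The inclusion of `(nD) ^ X` into the bounded continuous functions. -/
def Cb.ofDisc (n : ℕ) (f : KMap X (Metric.closedBall (0 : 𝕜) n)) : Cb 𝕜 X :=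
  BoundedContinuousFunction.ofNormedAddCommGroup (fun x => (f.toMap x : 𝕜))
    (continuous_subtype_val.comp f.toMap.continuous) n
    fun x => mem_closedBall_zero_iff.1 (f.toMap x).2

instance : TopologicalSpace (Cb 𝕜 X) :=
  ⨆ n : ℕ, TopologicalSpace.coinduced (Cb.ofDisc n) inferInstance

@[ext] theorem Cb.ext {f g : Cb 𝕜 X} (h : ∀ x, f x = g x) : f = g := DFunLike.ext _ _ h

@[simp] theorem Cb.add_apply (f g : Cb 𝕜 X) (x : X) : (f + g) x = f x + g x := rfl

@[simp] theorem Cb.smul_apply (c : 𝕜) (f : Cb 𝕜 X) (x : X) : (c • f) x = c * f x := rfl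

@[simp] theorem Cb.one_apply (x : X) : (1 : Cb 𝕜 X) x = 1 := rfl

@[simp] theorem Cb.ofDisc_apply (n : ℕ) (f : KMap X (Metric.closedBall (0 : 𝕜) n)) (x : X) :
    Cb.ofDisc n f x = f.toMap x := rfl

/-- The continuous map underlying a bounded continuous function. -/
def Cb.toMap (f : Cb 𝕜 X) : C(X, 𝕜) := BoundedContinuousFunction.toContinuousMap f

@[simp] theorem Cb.toMap_apply (f : Cb 𝕜 X) (x : X) : f.toMap x = f x := rfl

/-- A bounded continuous function built from a continuous function and a bound. -/
def Cb.mk (f : C(X, 𝕜)) (C : ℝ) (hC : ∀ x, ‖f x‖ ≤ C) : Cb 𝕜 X :=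
  BoundedContinuousFunction.ofNormedAddCommGroup f f.continuous C hC

@[simp] theorem Cb.mk_apply (f : C(X, 𝕜)) (C : ℝ) (hC : ∀ x, ‖f x‖ ≤ C) (x : X) :
    Cb.mk f C hC x = f x := rfl

theorem Cb.exists_bound (f : Cb 𝕜 X) : ∃ C : ℝ, ∀ x, ‖f x‖ ≤ C :=
  ⟨_, BoundedContinuousFunction.norm_coe_le_norm (show X →ᵇ 𝕜 from f)⟩

theorem Cb.continuous_ofDisc (n : ℕ) :
    Continuous (Cb.ofDisc n : KMap X (Metric.closedBall (0 : 𝕜) n) → Cb 𝕜 X) :=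
  continuous_iff_coinduced_le.2 (le_iSup (fun n : ℕ => TopologicalSpace.coinduced
    (Cb.ofDisc n : KMap X (Metric.closedBall (0 : 𝕜) n) → Cb 𝕜 X) inferInstance) n)

theorem Cb.continuous_of {Z : Type*} [TopologicalSpace Z] {g : Cb 𝕜 X → Z}
    (hg : ∀ n : ℕ, Continuous fun f : KMap X (Metric.closedBall (0 : 𝕜) n) => g (Cb.ofDisc n f)) :
    Continuous g :=
  continuous_iSup_dom.2 fun n => continuous_coinduced_dom.2 (hg n)

theorem Cb.continuous_comp {L : Type u} [TopologicalSpace L] [CompactSpace L] [T2Space L]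
    (i : C(L, X)) : Continuous fun f : Cb 𝕜 X => f.toMap.comp i :=
  Cb.continuous_of fun _ => (ContinuousMap.continuous_postcomp
    (⟨Subtype.val, continuous_subtype_val⟩ : C(Metric.closedBall (0 : 𝕜) _, 𝕜))).comp
      (KMap.continuous_comp i)

theorem Cb.continuous_eval (x : X) : Continuous fun f : Cb 𝕜 X => f x :=
  Cb.continuous_of fun _ => continuous_subtype_val.comp (KMap.continuous_eval x)

variable (𝕜) in
/-- The Dirac functional `f ↦ f x`. -/
def diracFunctional (x : X) : NatDual 𝕜 (Cb 𝕜 X) :=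
  (⟨⟨⟨fun f => f x, fun _ _ => rfl⟩, fun _ _ => rfl⟩, Cb.continuous_eval x⟩ : Cb 𝕜 X →L[𝕜] 𝕜)

@[simp] theorem diracFunctional_apply (x : X) (f : Cb 𝕜 X) : diracFunctional 𝕜 x f = f x := rfl

variable (𝕜 X) in
/-- The space `M(X)`: the closed linear span of the Dirac functionals in the natural dual of
`Cb(X)`. -/
def measFunctionals : Set (NatDual 𝕜 (Cb 𝕜 X)) :=
  closure (Submodule.span 𝕜 (Set.range (diracFunctional 𝕜 : X → NatDual 𝕜 (Cb 𝕜 X))))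

theorem dirac_mem_measFunctionals (x : X) : diracFunctional 𝕜 x ∈ measFunctionals 𝕜 X :=
  subset_closure (Submodule.subset_span ⟨x, rfl⟩)

theorem add_mem_measFunctionals {φ ψ : NatDual 𝕜 (Cb 𝕜 X)} (hφ : φ ∈ measFunctionals 𝕜 X)
    (hψ : ψ ∈ measFunctionals 𝕜 X) : φ + ψ ∈ measFunctionals 𝕜 X := by
  have h1 : ∀ χ ∈ Submodule.span 𝕜 (Set.range (diracFunctional 𝕜 : X → NatDual 𝕜 (Cb 𝕜 X))),
      χ + φ ∈ measFunctionals 𝕜 X := fun χ hχ => by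
    rw [add_comm]
    exact map_mem_closure (f := fun θ => θ + χ) (NatDual.continuous_add_right χ) hφ
      fun θ hθ => Submodule.add_mem _ hθ hχ
  have h2 := map_mem_closure (f := fun θ => θ + φ) (NatDual.continuous_add_right φ) hψ
    (t := measFunctionals 𝕜 X) h1
  rwa [measFunctionals, closure_closure, add_comm] at h2

theorem smul_mem_measFunctionals (c : 𝕜) {φ : NatDual 𝕜 (Cb 𝕜 X)}
    (hφ : φ ∈ measFunctionals 𝕜 X) : c • φ ∈ measFunctionals 𝕜 X :=
  map_mem_closure (NatDual.continuous_const_smul c) hφ fun _ hχ => Submodule.smul_mem _ c hχ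

theorem zero_mem_measFunctionals : (0 : NatDual 𝕜 (Cb 𝕜 X)) ∈ measFunctionals 𝕜 X :=
  subset_closure (Submodule.zero_mem _)

theorem adjoint_mem_measFunctionals {Y : Type u} [TopologicalSpace Y] (T : Cb 𝕜 X →L[𝕜] Cb 𝕜 Y)
    (hT : ∀ y, NatDual.adjoint T (diracFunctional 𝕜 y) ∈ measFunctionals 𝕜 X)
    {φ : NatDual 𝕜 (Cb 𝕜 Y)} (hφ : φ ∈ measFunctionals 𝕜 Y) :
    NatDual.adjoint T φ ∈ measFunctionals 𝕜 X := by
  have h := map_mem_closure (NatDual.continuous_adjoint T) hφ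
    (t := measFunctionals 𝕜 X) fun χ hχ => by
      induction hχ using Submodule.span_induction with
      | mem x hx => obtain ⟨y, rfl⟩ := hx; exact hT y
      | zero => exact zero_mem_measFunctionals
      | add x y _ _ hx hy => exact add_mem_measFunctionals hx hy
      | smul a x _ hx => exact smul_mem_measFunctionals a hx
  rwa [measFunctionals, closure_closure] at h

/-! ### The space `P(X)` -/

variable (𝕜 X) in
/-- The space `P(X)`: the positive normalised functionals in `M(X)`, with the subspace topology. -/
def ProbSpace : Type u :=
  {φ : NatDual 𝕜 (Cb 𝕜 X) // φ ∈ measFunctionals 𝕜 X ∧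
    (∀ f : Cb 𝕜 X, (∀ x, 0 ≤ f x) → 0 ≤ φ f) ∧ φ 1 = 1}

instance : TopologicalSpace (ProbSpace 𝕜 X) := inferInstanceAs (TopologicalSpace (Subtype _))

instance : FunLike (ProbSpace 𝕜 X) (Cb 𝕜 X) 𝕜 where
  coe φ := φ.1
  coe_injective _ _ h := Subtype.ext (DFunLike.coe_injective h)

@[ext] theorem ProbSpace.ext {φ ψ : ProbSpace 𝕜 X} (h : ∀ f, φ f = ψ f) : φ = ψ :=
  DFunLike.ext _ _ h

theorem ProbSpace.continuous_val :
    Continuous (Subtype.val : ProbSpace 𝕜 X → NatDual 𝕜 (Cb 𝕜 X)) :=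
  continuous_subtype_val

theorem ProbSpace.continuous_eval (f : Cb 𝕜 X) : Continuous fun φ : ProbSpace 𝕜 X => φ f :=
  (NatDual.continuous_eval f).comp ProbSpace.continuous_val

theorem ProbSpace.isClosedEmbedding :
    IsClosedEmbedding (fun φ : ProbSpace 𝕜 X => NatDual.toKMap φ.1) := by
  refine NatDual.isClosedEmbedding_toKMap.comp (IsClosed.isClosedEmbedding_subtypeVal ?_)
  refine IsClosed.inter isClosed_closure (IsClosed.inter ?_
    (isClosed_eq (NatDual.continuous_eval 1) continuous_const))
  have h : {φ : NatDual 𝕜 (Cb 𝕜 X) | ∀ f : Cb 𝕜 X, (∀ x, 0 ≤ f x) → 0 ≤ φ f} =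
      ⋂ (f : Cb 𝕜 X) (_ : ∀ x, 0 ≤ f x),
        ({φ | 0 ≤ RCLike.re (φ f)} ∩ {φ | RCLike.im (φ f) = 0}) := by
    ext φ
    simp only [Set.mem_ofPred_eq, Set.mem_iInter, Set.mem_inter_iff]
    exact forall₂_congr fun f _ => RCLike.nonneg_iff
  change IsClosed {φ : NatDual 𝕜 (Cb 𝕜 X) | ∀ f : Cb 𝕜 X, (∀ x, 0 ≤ f x) → 0 ≤ φ f}
  rw [h]
  exact isClosed_iInter fun f => isClosed_iInter fun _ =>
    (isClosed_le continuous_const (RCLike.continuous_re.comp (NatDual.continuous_eval f))).inter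
      (isClosed_eq (RCLike.continuous_im.comp (NatDual.continuous_eval f)) continuous_const)

instance : T2Space (ProbSpace 𝕜 X) :=
  T2Space.of_injective_continuous (f := fun (φ : ProbSpace 𝕜 X) (f : Cb 𝕜 X) => φ f)
    DFunLike.coe_injective (continuous_pi ProbSpace.continuous_eval)

theorem ProbSpace.isHKSpace : IsHKSpace (ProbSpace 𝕜 X) :=
  .of_t2 ((Kify.isKSpace _).of_isClosedEmbedding ProbSpace.isClosedEmbedding)

theorem ProbSpace.nonneg (φ : ProbSpace 𝕜 X) {f : Cb 𝕜 X} (hf : ∀ x, 0 ≤ f x) : 0 ≤ φ f :=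
  φ.2.2.1 f hf

theorem ProbSpace.map_one (φ : ProbSpace 𝕜 X) : φ 1 = 1 := φ.2.2.2

theorem ProbSpace.norm_apply_le_of_real (φ : ProbSpace 𝕜 X) (f : Cb 𝕜 X) (r : X → ℝ) {C : ℝ}
    (hr : ∀ x, f x = (r x : 𝕜)) (hC : ∀ x, |r x| ≤ C) : ‖φ f‖ ≤ C := by
  have h1 : 0 ≤ φ ((C : 𝕜) • 1 + f) := φ.nonneg fun x => by
    rw [Cb.add_apply, Cb.smul_apply, hr, Cb.one_apply, mul_one, ← RCLike.ofReal_add]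
    exact RCLike.ofReal_nonneg.2 (by linarith [neg_le_of_abs_le (hC x)])
  have h2 : 0 ≤ φ ((C : 𝕜) • 1 + (-1 : 𝕜) • f) := φ.nonneg fun x => by
    rw [Cb.add_apply, Cb.smul_apply, Cb.smul_apply, hr, Cb.one_apply, mul_one, neg_one_mul,
      ← RCLike.ofReal_neg, ← RCLike.ofReal_add]
    exact RCLike.ofReal_nonneg.2 (by linarith [le_of_abs_le (hC x)])
  have e1 : φ ((C : 𝕜) • 1 + f) = C + φ f := by
    change φ.1 _ = C + φ.1 f
    rw [map_add, map_smul, φ.2.2.2, smul_eq_mul, mul_one]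
  have e2 : φ ((C : 𝕜) • 1 + (-1 : 𝕜) • f) = C - φ f := by
    change φ.1 _ = C - φ.1 f
    rw [map_add, map_smul, map_smul, φ.2.2.2, smul_eq_mul, mul_one, smul_eq_mul]
    ring
  rw [e1] at h1
  rw [e2] at h2
  obtain ⟨a1, b1⟩ := RCLike.nonneg_iff.1 h1
  obtain ⟨a2, _⟩ := RCLike.nonneg_iff.1 h2
  simp only [map_add, map_sub, RCLike.ofReal_re, RCLike.ofReal_im, zero_add] at a1 a2 b1
  have e : φ f = (RCLike.re (φ f) : 𝕜) := by
    conv_lhs => rw [← RCLike.re_add_im (φ f), b1]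
    simp
  rw [e, RCLike.norm_ofReal]
  exact abs_le.2 ⟨by linarith, by linarith⟩

/-- A uniform bound for the values of positive normalised functionals. -/
theorem ProbSpace.norm_apply_le (φ : ProbSpace 𝕜 X) (f : Cb 𝕜 X) {C : ℝ}
    (hC : ∀ x, ‖f x‖ ≤ C) : ‖φ f‖ ≤ 2 * C := by
  let g : Cb 𝕜 X := Cb.mk ⟨fun x => ((RCLike.re (f x) : ℝ) : 𝕜), by
    exact RCLike.continuous_ofReal.comp (RCLike.continuous_re.comp f.toMap.continuous)⟩ C
    fun x => by simpa using (RCLike.abs_re_le_norm (f x)).trans (hC x)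
  let h : Cb 𝕜 X := Cb.mk ⟨fun x => ((RCLike.im (f x) : ℝ) : 𝕜), by
    exact RCLike.continuous_ofReal.comp (RCLike.continuous_im.comp f.toMap.continuous)⟩ C
    fun x => by simpa using (RCLike.abs_im_le_norm (f x)).trans (hC x)
  have e : f = g + (RCLike.I : 𝕜) • h := by
    ext x
    simpa [g, h, mul_comm] using (RCLike.re_add_im (f x)).symm
  have e' : φ f = φ g + RCLike.I * φ h := by
    conv_lhs => rw [e]
    change φ.1 _ = φ.1 g + _ * φ.1 h
    rw [map_add, map_smul, smul_eq_mul]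
  have h1 : ‖φ g‖ ≤ C := φ.norm_apply_le_of_real g (fun x => RCLike.re (f x)) (fun _ => rfl)
    fun x => (RCLike.abs_re_le_norm (f x)).trans (hC x)
  have h2 : ‖φ h‖ ≤ C := φ.norm_apply_le_of_real h (fun x => RCLike.im (f x)) (fun _ => rfl)
    fun x => (RCLike.abs_im_le_norm (f x)).trans (hC x)
  have h3 : ‖(RCLike.I : 𝕜) * φ h‖ ≤ ‖φ h‖ := by
    rw [norm_mul]
    refine mul_le_of_le_one_left (norm_nonneg _) ?_
    rcases eq_or_ne (RCLike.I : 𝕜) 0 with hI | hI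
    · simp [hI]
    · exact (RCLike.norm_I_of_ne_zero hI).le
  rw [e']
  linarith [norm_add_le (φ g) (RCLike.I * φ h)]

/-! ### Functoriality, unit and multiplication -/

section Monad

variable {Y : Type u} [TopologicalSpace Y]

/-- Adjoints of positive unital maps act on the spaces `P`. -/
def ProbSpace.adjoint (T : Cb 𝕜 X →L[𝕜] Cb 𝕜 Y)
    (hT : ∀ y, NatDual.adjoint T (diracFunctional 𝕜 y) ∈ measFunctionals 𝕜 X)
    (hpos : ∀ f : Cb 𝕜 X, (∀ x, 0 ≤ f x) → ∀ y, 0 ≤ T f y) (hone : T 1 = 1)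
    (φ : ProbSpace 𝕜 Y) : ProbSpace 𝕜 X :=
  ⟨NatDual.adjoint T φ.1, adjoint_mem_measFunctionals T hT φ.2.1,
    fun f hf => φ.2.2.1 _ (hpos f hf), by rw [NatDual.adjoint_apply, hone, φ.2.2.2]⟩

theorem ProbSpace.continuous_adjoint (T : Cb 𝕜 X →L[𝕜] Cb 𝕜 Y)
    (hT : ∀ y, NatDual.adjoint T (diracFunctional 𝕜 y) ∈ measFunctionals 𝕜 X)
    (hpos : ∀ f : Cb 𝕜 X, (∀ x, 0 ≤ f x) → ∀ y, 0 ≤ T f y) (hone : T 1 = 1) :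
    Continuous (ProbSpace.adjoint T hT hpos hone) :=
  ((NatDual.continuous_adjoint T).comp ProbSpace.continuous_val).subtype_mk _

/-- Precomposition with a continuous map, on bounded continuous functions. -/
def Cb.precomp (g : C(X, Y)) : Cb 𝕜 Y →L[𝕜] Cb 𝕜 X where
  toFun f := BoundedContinuousFunction.compContinuous f g
  map_add' _ _ := rfl
  map_smul' _ _ := rfl
  cont := by
    refine Cb.continuous_of fun n => ?_
    have h : Continuous fun f : KMap Y (Metric.closedBall (0 : 𝕜) n) =>
        KMap.mk (f.toMap.comp g) := by
      refine KMap.continuous_map (g := fun f => f.comp g) ?_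
      intro K _ _ _ p L _ _ _ i
      exact (CO.continuous_comp (g.comp i)).comp p.continuous
    exact (Cb.continuous_ofDisc n).comp h

@[simp] theorem Cb.precomp_apply (g : C(X, Y)) (f : Cb 𝕜 Y) (x : X) :
    Cb.precomp g f x = f (g x) := rfl

variable (𝕜) in
/-- The pushforward `P(X) → P(Y)`: `(g_* φ)(f) = φ(f ∘ g)`. -/
def ProbSpace.map (g : C(X, Y)) : C(ProbSpace 𝕜 X, ProbSpace 𝕜 Y) where
  toFun := ProbSpace.adjoint (Cb.precomp g) (fun x => dirac_mem_measFunctionals (g x))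
    (fun _ hf x => hf (g x)) rfl
  continuous_toFun := ProbSpace.continuous_adjoint _ _ _ _

@[simp] theorem ProbSpace.map_apply (g : C(X, Y)) (φ : ProbSpace 𝕜 X) (f : Cb 𝕜 Y) :
    ProbSpace.map 𝕜 g φ f = φ (Cb.precomp g f) := rfl

variable (𝕜) in
/-- The Dirac functionals as elements of `P(X)`. -/
def ProbSpace.dirac (x : X) : ProbSpace 𝕜 X :=
  ⟨diracFunctional 𝕜 x, dirac_mem_measFunctionals x, fun _ hf => hf x, rfl⟩

@[simp] theorem ProbSpace.dirac_apply (x : X) (f : Cb 𝕜 X) : ProbSpace.dirac 𝕜 x f = f x := rfl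

theorem ProbSpace.continuous_dirac (hX : IsKSpace X) :
    Continuous (ProbSpace.dirac 𝕜 : X → ProbSpace 𝕜 X) := by
  refine Continuous.subtype_mk (continuous_induced_rng.2 (hX.continuous fun K _ _ _ q => ?_)) _
  refine Kify.continuous_of_compact (p := fun k => CO.mk _) (CO.continuous_of fun L _ _ _ i => ?_)
  refine ContinuousMap.continuous_of_continuous_uncurry _ ?_
  have h : Continuous fun l => (i l).toMap.comp q := (Cb.continuous_comp q).comp i.continuous
  exact (h.comp continuous_snd).eval continuous_fst

/-- The evaluation map `f ↦ (φ ↦ φ f)` from `Cb(X)` to `Cb(P(X))`. -/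
def Cb.toBidual : Cb 𝕜 X →L[𝕜] Cb 𝕜 (ProbSpace 𝕜 X) where
  toFun f := Cb.mk ⟨fun φ => φ f, ProbSpace.continuous_eval f⟩ (2 * f.exists_bound.choose)
    fun φ => φ.norm_apply_le f f.exists_bound.choose_spec
  map_add' f g := Cb.ext fun φ => map_add φ.1 f g
  map_smul' c f := Cb.ext fun φ => map_smul φ.1 c f
  cont := by
    refine Cb.continuous_of fun n => ?_
    let G : C(X, Metric.closedBall (0 : 𝕜) n) →
        C(ProbSpace 𝕜 X, Metric.closedBall (0 : 𝕜) (2 * n : ℕ)) := fun f =>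
      ⟨fun φ => ⟨φ (Cb.ofDisc n (KMap.mk f)), mem_closedBall_zero_iff.2 (by
        rw [Nat.cast_mul]
        exact φ.norm_apply_le _ fun x => mem_closedBall_zero_iff.1 (f x).2)⟩,
        (ProbSpace.continuous_eval _).subtype_mk _⟩
    have h : Continuous fun f : KMap X (Metric.closedBall (0 : 𝕜) n) =>
        KMap.mk (G f.toMap) := by
      refine KMap.continuous_map ?_
      intro K _ _ _ p L _ _ _ i
      refine ContinuousMap.continuous_of_continuous_uncurry _ (Continuous.subtype_mk ?_ _)
      have hq : Continuous fun k => Cb.ofDisc n (Kify.mk (p k)) :=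
        (Cb.continuous_ofDisc n).comp (Kify.continuous_of_compact p.continuous)
      have hl : Continuous fun l => (i l).1.toKMap.toMap.comp ⟨_, hq⟩ :=
        (KMap.continuous_comp _).comp
          (NatDual.continuous_toKMap.comp (ProbSpace.continuous_val.comp i.continuous))
      exact (hl.comp continuous_snd).eval continuous_fst
    exact (Cb.continuous_ofDisc (2 * n)).comp h

@[simp] theorem Cb.toBidual_apply (f : Cb 𝕜 X) (φ : ProbSpace 𝕜 X) : Cb.toBidual f φ = φ f := rfl

variable (𝕜 X) in
/-- The multiplication `P(P(X)) → P(X)`: `(∫ π)(f) = π (φ ↦ φ f)`. -/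
def ProbSpace.join : C(ProbSpace 𝕜 (ProbSpace 𝕜 X), ProbSpace 𝕜 X) where
  toFun := ProbSpace.adjoint Cb.toBidual (fun φ => φ.2.1) (fun _ hf φ => φ.nonneg hf)
    (Cb.ext fun φ => φ.map_one)
  continuous_toFun := ProbSpace.continuous_adjoint _ _ _ _

@[simp] theorem ProbSpace.join_apply (π : ProbSpace 𝕜 (ProbSpace 𝕜 X)) (f : Cb 𝕜 X) :
    ProbSpace.join 𝕜 X π f = π (Cb.toBidual f) := rfl

end Monad

end Functionals

/-! ### The probability monad on hk-spaces and its restriction to Polish spaces -/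

/-- The property of being an hk-space. -/
def isHK : ObjectProperty TopCat.{u} := fun X => IsHKSpace X

/-- The category of hk-spaces and continuous maps. -/
abbrev HKTop : Type (u + 1) := isHK.{u}.FullSubcategory

/-- The property of being a Polish space, on hk-spaces. Every Polish space is an hk-space, see
`IsHKSpace.of_polishSpace`. -/
def isPolish : ObjectProperty HKTop.{u} := fun X => PolishSpace X.obj

/-- The category of Polish spaces and continuous maps. -/
abbrev Pol : Type (u + 1) := isPolish.{u}.FullSubcategory

/-- The probability monad on hk-spaces. -/
def probMonad (𝕜 : Type) [RCLike 𝕜] : Monad HKTop.{u} where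
  obj X := ⟨TopCat.of (ProbSpace 𝕜 X.obj), ProbSpace.isHKSpace⟩
  map g := ObjectProperty.homMk (TopCat.ofHom (ProbSpace.map 𝕜 g.hom.hom))
  η :=
    { app := fun X => ObjectProperty.homMk (TopCat.ofHom
        ⟨ProbSpace.dirac 𝕜, ProbSpace.continuous_dirac X.property.isKSpace⟩) }
  μ := { app := fun X => ObjectProperty.homMk (TopCat.ofHom (ProbSpace.join 𝕜 X.obj)) }

/-- The restriction of a monad to a full subcategory that its endofunctor preserves. -/
def restrictMonad {C : Type*} [Category C] (T : Monad C) (Q : ObjectProperty C)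
    (h : ∀ X, Q X → Q (T.obj X)) : Monad Q.FullSubcategory where
  obj X := ⟨T.obj X.obj, h X.obj X.property⟩
  map g := ObjectProperty.homMk (T.map g.hom)
  η :=
    { app := fun X => ObjectProperty.homMk (T.η.app X.obj)
      naturality := fun _ _ g => ObjectProperty.hom_ext _ (T.η.naturality g.hom) }
  μ :=
    { app := fun X => ObjectProperty.homMk (T.μ.app X.obj)
      naturality := fun _ _ g => ObjectProperty.hom_ext _ (T.μ.naturality g.hom) }
  assoc X := ObjectProperty.hom_ext _ (T.assoc X.obj)
  left_unit X := ObjectProperty.hom_ext _ (T.left_unit X.obj)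
  right_unit X := ObjectProperty.hom_ext _ (T.right_unit X.obj)

/-! ### The Giry monad on Polish spaces -/

section Giry

attribute [local instance] borel

theorem borelSpace_borel (X : Type u) [TopologicalSpace X] : BorelSpace X := ⟨rfl⟩

attribute [local instance] borelSpace_borel

/-- The Borel probability measures on a space, with the topology of weak convergence. -/
def BorelProb (X : Type u) [TopologicalSpace X] : Type u := ProbabilityMeasure X

instance (X : Type u) [TopologicalSpace X] : TopologicalSpace (BorelProb X) :=
  (inferInstance : TopologicalSpace (ProbabilityMeasure X))

variable {X : Type u} [TopologicalSpace X]

/-- The measure underlying an element of `BorelProb X`. -/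
def BorelProb.toMeasure (μ : BorelProb X) : Measure X := ProbabilityMeasure.toMeasure (Ω := X) μ

instance (μ : BorelProb X) : IsProbabilityMeasure μ.toMeasure := μ.2

theorem BorelProb.continuous_lintegral (f : X →ᵇ NNReal) :
    Continuous fun μ : BorelProb X => ∫⁻ x, f x ∂μ.toMeasure :=
  ProbabilityMeasure.continuous_lintegral_boundedContinuousFunction f

theorem BorelProb.continuous_of {Z : Type*} [TopologicalSpace Z] {g : Z → BorelProb X}
    (hg : ∀ f : X →ᵇ NNReal, Continuous fun z => ∫⁻ x, f x ∂(g z).toMeasure) : Continuous g :=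
  (ProbabilityMeasure.continuous_iff_forall_continuous_lintegral (Ω := X)).2 hg

theorem BorelProb.ext_of_lintegral [HasOuterApproxClosed X] {μ ν : BorelProb X}
    (h : ∀ f : X →ᵇ NNReal, ∫⁻ x, f x ∂μ.toMeasure = ∫⁻ x, f x ∂ν.toMeasure) : μ = ν :=
  ProbabilityMeasure.toMeasure_injective (Ω := X)
    (ext_of_forall_lintegral_eq_of_IsFiniteMeasure (μ := μ.toMeasure) (ν := ν.toMeasure) h)

theorem measurable_coe_boundedContinuous (f : X →ᵇ NNReal) :
    Measurable fun x => (f x : ENNReal) :=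
  (ENNReal.continuous_coe.comp f.continuous).measurable

theorem BorelProb.measurable_toMeasure [HasOuterApproxClosed X] :
    Measurable (BorelProb.toMeasure : BorelProb X → Measure X) := by
  refine Measurable.measure_of_isPiSystem_of_isProbabilityMeasure borel_eq_generateFrom_isClosed
    isPiSystem_isClosed fun F hF => ?_
  exact measurable_of_tendsto_metrizable
    (f := fun n (μ : BorelProb X) => ∫⁻ x, hF.apprSeq n x ∂μ.toMeasure)
    (fun n => (BorelProb.continuous_lintegral _).measurable)
    (tendsto_pi_nhds.2 fun μ => HasOuterApproxClosed.tendsto_lintegral_apprSeq hF μ.toMeasure)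

/-- The pushforward of a Borel probability measure. -/
def BorelProb.map {Y : Type u} [TopologicalSpace Y] (g : C(X, Y)) : C(BorelProb X, BorelProb Y) where
  toFun μ := ⟨μ.toMeasure.map g, Measure.isProbabilityMeasure_map g.continuous.measurable.aemeasurable⟩
  continuous_toFun := BorelProb.continuous_of fun f => by
    have h : ∀ μ : BorelProb X, ∫⁻ y, f y ∂(μ.toMeasure.map g) =
        ∫⁻ x, f.compContinuous g x ∂μ.toMeasure := fun μ =>
      lintegral_map (by fun_prop) g.continuous.measurable
    exact (BorelProb.continuous_lintegral (f.compContinuous g)).congr fun μ => (h μ).symm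

theorem BorelProb.lintegral_map {Y : Type u} [TopologicalSpace Y] (g : C(X, Y)) (μ : BorelProb X)
    {f : Y → ENNReal} (hf : Measurable f) :
    ∫⁻ y, f y ∂(BorelProb.map g μ).toMeasure = ∫⁻ x, f (g x) ∂μ.toMeasure :=
  MeasureTheory.lintegral_map hf g.continuous.measurable

/-- The Dirac measures. -/
def BorelProb.dirac : C(X, BorelProb X) where
  toFun x := ⟨Measure.dirac x, inferInstance⟩
  continuous_toFun := BorelProb.continuous_of fun f =>
    (ENNReal.continuous_coe.comp f.continuous).congr fun x =>
      (lintegral_dirac' x (ENNReal.continuous_coe.comp f.continuous).measurable).symm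

theorem BorelProb.lintegral_dirac (x : X) {f : X → ENNReal} (hf : Measurable f) :
    ∫⁻ y, f y ∂(BorelProb.dirac x).toMeasure = f x :=
  lintegral_dirac' x hf

theorem BorelProb.measurable_lintegral [HasOuterApproxClosed X] {f : X → ENNReal}
    (hf : Measurable f) : Measurable fun μ : BorelProb X => ∫⁻ x, f x ∂μ.toMeasure :=
  (Measure.measurable_lintegral hf).comp BorelProb.measurable_toMeasure

/-- The mean of a measure on `BorelProb X`, that is, the measure `A ↦ ∫ μ(A) dπ(μ)`. -/
def BorelProb.meanMeasure (π : BorelProb (BorelProb X)) : Measure X :=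
  Measure.join (π.toMeasure.map BorelProb.toMeasure)

theorem BorelProb.meanMeasure_apply [HasOuterApproxClosed X] (π : BorelProb (BorelProb X))
    {A : Set X} (hA : MeasurableSet A) :
    BorelProb.meanMeasure π A = ∫⁻ μ, μ.toMeasure A ∂π.toMeasure := by
  rw [meanMeasure, Measure.join_apply hA,
    MeasureTheory.lintegral_map (Measure.measurable_coe hA) BorelProb.measurable_toMeasure]

theorem BorelProb.lintegral_meanMeasure [HasOuterApproxClosed X] (π : BorelProb (BorelProb X))
    {f : X → ENNReal} (hf : Measurable f) :
    ∫⁻ x, f x ∂BorelProb.meanMeasure π = ∫⁻ μ, ∫⁻ x, f x ∂μ.toMeasure ∂π.toMeasure := by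
  rw [meanMeasure, Measure.lintegral_join hf.aemeasurable,
    MeasureTheory.lintegral_map (Measure.measurable_lintegral hf) BorelProb.measurable_toMeasure]

theorem BorelProb.exists_boundedContinuous_lintegral (f : X →ᵇ NNReal) :
    ∃ F : BorelProb X →ᵇ NNReal, ∀ μ, (F μ : ENNReal) = ∫⁻ x, f x ∂μ.toMeasure := by
  have hC : ∀ μ : BorelProb X, ∫⁻ x, f x ∂μ.toMeasure ≤ (nndist f 0 : NNReal) := fun μ => by
    refine (lintegral_mono fun x =>
      ENNReal.coe_le_coe.2 (BoundedContinuousFunction.NNReal.upper_bound f x)).trans ?_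
    simp
  have hne : ∀ μ : BorelProb X, ∫⁻ x, f x ∂μ.toMeasure ≠ ⊤ := fun μ =>
    ((hC μ).trans_lt ENNReal.coe_lt_top).ne
  refine ⟨BoundedContinuousFunction.mkOfBound
    ⟨fun μ => (∫⁻ x, f x ∂μ.toMeasure).toNNReal, ?_⟩ (nndist f 0) fun μ ν => ?_, fun μ => ?_⟩
  · exact ENNReal.continuousOn_toNNReal.comp_continuous (BorelProb.continuous_lintegral f) hne
  · have h : ∀ μ : BorelProb X, (∫⁻ x, f x ∂μ.toMeasure).toNNReal ≤ nndist f 0 := fun μ =>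
      by
      simpa only [ENNReal.toNNReal_coe] using ENNReal.toNNReal_mono ENNReal.coe_ne_top (hC μ)
    have h1 := NNReal.coe_le_coe.2 (h μ)
    have h2 := NNReal.coe_le_coe.2 (h ν)
    rw [NNReal.dist_eq]
    have h3 := NNReal.coe_nonneg (∫⁻ x, f x ∂μ.toMeasure).toNNReal
    have h4 := NNReal.coe_nonneg (∫⁻ x, f x ∂ν.toMeasure).toNNReal
    simp only [ContinuousMap.coe_mk]
    exact abs_sub_le_iff.2 ⟨by linarith, by linarith⟩
  · exact ENNReal.coe_toNNReal (hne μ)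

/-- The multiplication of the Giry monad. -/
def BorelProb.mean [HasOuterApproxClosed X] : C(BorelProb (BorelProb X), BorelProb X) where
  toFun π := ⟨BorelProb.meanMeasure π, ⟨by
    rw [BorelProb.meanMeasure_apply π MeasurableSet.univ]
    simp⟩⟩
  continuous_toFun := BorelProb.continuous_of fun f => by
    obtain ⟨F, hF⟩ := BorelProb.exists_boundedContinuous_lintegral f
    refine (BorelProb.continuous_lintegral F).congr fun π => ?_
    simp only [hF]
    exact (BorelProb.lintegral_meanMeasure π (by fun_prop)).symm

theorem BorelProb.lintegral_mean [HasOuterApproxClosed X] (π : BorelProb (BorelProb X))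
    {f : X → ENNReal} (hf : Measurable f) :
    ∫⁻ x, f x ∂(BorelProb.mean π).toMeasure = ∫⁻ μ, ∫⁻ x, f x ∂μ.toMeasure ∂π.toMeasure :=
  BorelProb.lintegral_meanMeasure π hf

/-- The Giry monad on Polish spaces: Borel probability measures with the topology of weak
convergence, pushforward of measures, Dirac measures and means of measures. It takes as an argument
the fact that it maps Polish spaces to Polish spaces. -/
def giryMonad (h : ∀ (X : Type u) [TopologicalSpace X] [PolishSpace X], PolishSpace (BorelProb X)) :
    Monad Pol.{u} where
  obj X := ⟨⟨TopCat.of (BorelProb X.obj.obj),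
    have : PolishSpace X.obj.obj := X.property
    have := h X.obj.obj
    IsHKSpace.of_polishSpace⟩,
    have : PolishSpace X.obj.obj := X.property
    h X.obj.obj⟩
  map g := ObjectProperty.homMk (ObjectProperty.homMk (TopCat.ofHom (BorelProb.map g.hom.hom.hom)))
  map_id X := by
    have : PolishSpace X.obj.obj := X.property
    ext μ
    exact BorelProb.ext_of_lintegral (X := X.obj.obj) fun f =>
      BorelProb.lintegral_map (ContinuousMap.id X.obj.obj) μ (measurable_coe_boundedContinuous f)
  map_comp {X Y Z} g k := by
    have : PolishSpace Z.obj.obj := Z.property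
    ext μ
    refine BorelProb.ext_of_lintegral (X := Z.obj.obj) fun f => ?_
    have hf := measurable_coe_boundedContinuous f
    have e1 := BorelProb.lintegral_map (k.hom.hom.hom.comp g.hom.hom.hom) μ hf
    have e2 := BorelProb.lintegral_map k.hom.hom.hom (BorelProb.map g.hom.hom.hom μ) hf
    have e3 := BorelProb.lintegral_map g.hom.hom.hom μ
      (measurable_coe_boundedContinuous (f.compContinuous k.hom.hom.hom))
    exact e1.trans (e3.symm.trans e2.symm)
  η :=
    { app := fun X => ObjectProperty.homMk (ObjectProperty.homMk (TopCat.ofHom BorelProb.dirac))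
      naturality := fun X Y g => by
        have : PolishSpace Y.obj.obj := Y.property
        ext x
        refine BorelProb.ext_of_lintegral (X := Y.obj.obj) fun f => ?_
        have hf := measurable_coe_boundedContinuous f
        have e1 := BorelProb.lintegral_dirac (g.hom.hom.hom x) hf
        have e2 := BorelProb.lintegral_map g.hom.hom.hom (BorelProb.dirac x) hf
        have e3 := BorelProb.lintegral_dirac x
          (measurable_coe_boundedContinuous (f.compContinuous g.hom.hom.hom))
        exact e1.trans (e3.symm.trans e2.symm) }
  μ :=
    { app := fun X =>
        have : PolishSpace X.obj.obj := X.property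
        ObjectProperty.homMk (ObjectProperty.homMk (TopCat.ofHom BorelProb.mean))
      naturality := fun X Y g => by
        have : PolishSpace X.obj.obj := X.property
        have : PolishSpace Y.obj.obj := Y.property
        ext π
        refine BorelProb.ext_of_lintegral (X := Y.obj.obj) fun f => ?_
        have hf := measurable_coe_boundedContinuous f
        have hfg := measurable_coe_boundedContinuous (f.compContinuous g.hom.hom.hom)
        have e1 := BorelProb.lintegral_mean (BorelProb.map (BorelProb.map g.hom.hom.hom) π) hf
        have e2 := BorelProb.lintegral_map (BorelProb.map g.hom.hom.hom) π
          (BorelProb.measurable_lintegral hf)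
        have e3 := BorelProb.lintegral_map g.hom.hom.hom (BorelProb.mean π) hf
        have e4 := BorelProb.lintegral_mean π hfg
        refine (e1.trans (e2.trans ?_)).trans (e4.symm.trans e3.symm)
        exact lintegral_congr fun μ => BorelProb.lintegral_map g.hom.hom.hom μ hf }
  assoc X := by
    have : PolishSpace X.obj.obj := X.property
    have : PolishSpace (BorelProb X.obj.obj) := h X.obj.obj
    ext ρ
    refine BorelProb.ext_of_lintegral (X := X.obj.obj) fun f => ?_
    have hf := measurable_coe_boundedContinuous f
    have e1 := BorelProb.lintegral_mean (BorelProb.map BorelProb.mean ρ) hf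
    have e2 := BorelProb.lintegral_map BorelProb.mean ρ (BorelProb.measurable_lintegral hf)
    have e3 := BorelProb.lintegral_mean (BorelProb.mean ρ) hf
    have e4 := BorelProb.lintegral_mean ρ (BorelProb.measurable_lintegral hf)
    refine (e1.trans (e2.trans ?_)).trans (e4.symm.trans e3.symm)
    exact lintegral_congr fun π => BorelProb.lintegral_mean π hf
  left_unit X := by
    have : PolishSpace X.obj.obj := X.property
    ext μ
    refine BorelProb.ext_of_lintegral (X := X.obj.obj) fun f => ?_
    have hf := measurable_coe_boundedContinuous f
    exact (BorelProb.lintegral_mean (BorelProb.dirac μ) hf).trans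
      (BorelProb.lintegral_dirac μ (BorelProb.measurable_lintegral hf))
  right_unit X := by
    have : PolishSpace X.obj.obj := X.property
    ext μ
    refine BorelProb.ext_of_lintegral (X := X.obj.obj) fun f => ?_
    have hf := measurable_coe_boundedContinuous f
    have e1 := BorelProb.lintegral_mean (X := X.obj.obj) (BorelProb.map BorelProb.dirac μ) hf
    have e2 := BorelProb.lintegral_map (BorelProb.dirac (X := X.obj.obj)) μ
      (BorelProb.measurable_lintegral hf)
    refine e1.trans (e2.trans ?_)
    exact lintegral_congr fun x => BorelProb.lintegral_dirac x hf

end Giry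

/-! ### Baire, Radon and k-regular measures -/

section Measures

variable {𝕜 : Type} [RCLike 𝕜] {X : Type u} [TopologicalSpace X]

/-- The Baire σ-algebra, generated by the continuous real functions (equivalently, by the
continuous `𝕜`-valued functions). -/
@[reducible] def baire (X : Type u) [TopologicalSpace X] : MeasurableSpace X :=
  ⨆ f : C(X, ℝ), (borel ℝ).comap f

/-- A Borel measure with values in `𝕜` is a Radon measure if its variation is concentrated on
compact sets up to arbitrarily small mass. -/
def IsRadonMeasure (μ : @VectorMeasure X (borel X) 𝕜 _ _) : Prop :=
  ∀ ε : ℝ, 0 < ε → ∃ K : Set X, IsCompact K ∧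
    @VectorMeasure.variation X (borel X) 𝕜 _ _ _ μ Kᶜ < ENNReal.ofReal ε

/-- The integral of a function against a Baire measure with values in `𝕜`. -/
def baireIntegral (μ : @VectorMeasure X (baire X) 𝕜 _ _) (f : X → 𝕜) : 𝕜 :=
  @VectorMeasure.integral X 𝕜 𝕜 𝕜 (baire X) _ _ _ _ _ _ μ f (ContinuousLinearMap.mul ℝ 𝕜)

/-- A Baire measure is k-pre-regular if integration against it is a continuous functional on
`Cb(X)`. -/
def IsKPreRegular (μ : @VectorMeasure X (baire X) 𝕜 _ _) : Prop :=
  Continuous fun f : Cb 𝕜 X => baireIntegral μ f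

/-- A Baire measure is k-regular if it is k-pre-regular and integration against it is a functional
in `M(X)`. -/
def IsKRegular (μ : @VectorMeasure X (baire X) 𝕜 _ _) : Prop :=
  IsKPreRegular μ ∧ ∃ φ ∈ measFunctionals 𝕜 X, ∀ f : Cb 𝕜 X, φ f = baireIntegral μ f

end Measures

end

/-! Integration against a finite measure lies in `M(X)` because measures can be discretised
uniformly on compact families. Choose simple maps `s n` converging pointwise to the identity of the
Polish space `X`; integrating `f ∘ s n` instead of `f` gives a finite combination of Dirac
functionals. The colimit topology forces a compact family in `Cb 𝕜 X` to be uniformly bounded, and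
the family amounts to one bounded continuous map from `X` to a Banach space `C(L, 𝕜)`. Dominated
convergence for that map bounds the error for all members at once. Hence the integral is a limit of
these combinations in the natural dual, and is continuous
(`exists_mem_measFunctionals_of_dominated`).

Conversely, a functional in `P(X)` is continuous along monotone sequences, by Dini's theorem. Embed
`X` in the Hilbert cube and represent the induced functional there by Riesz; monotone continuity
shows that the resulting measure gives no mass to the complement of `X`, and then that it represents
the functional on every bounded continuous function (`exists_isProbabilityMeasure_eq_integral`).

The resulting bijection is a homeomorphism: evaluations are continuous on `P(X)`, and in the other
direction a weakly convergent sequence is tight, so that its integrals converge uniformly on compact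
families (`tendstoUniformly_integral_of_compact`). That the space of measures is Polish combines
separability, inherited from measures on the cube, with completeness of the Lévy–Prokhorov metric,
where Cauchy sequences are tight and Prokhorov's theorem applies. Since measures are determined by
their integrals, compatibility with the monad structures is checked on test functions. -/

/-! ### Compact families of bounded continuous functions -/

section CompactFamilies

open Filter

variable {𝕜 : Type} [RCLike 𝕜] {X : Type u} [TopologicalSpace X]

/-- Continuity on `Cb 𝕜 X` can be tested on compact Hausdorff spaces. -/
theorem Cb.continuous_of_compact {Z : Type*} [TopologicalSpace Z] {g : Cb 𝕜 X → Z}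
    (hg : ∀ (L : Type u) [TopologicalSpace L] [CompactSpace L] [T2Space L] (i : C(L, Cb 𝕜 X)),
      Continuous fun l => g (i l)) : Continuous g :=
  Cb.continuous_of fun n => (Kify.isKSpace _).continuous fun L _ _ _ p =>
    hg L ⟨fun l => Cb.ofDisc n (p l), (Cb.continuous_ofDisc n).comp p.continuous⟩

theorem KMap.isClosed_of_finite {n : ℕ} {S : Set (KMap X (Metric.closedBall (0 : 𝕜) n))}
    (hS : S.Finite) : IsClosed S := by
  have : T2Space (KMap X (Metric.closedBall (0 : 𝕜) n)) :=
    T2Space.of_injective_continuous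
      (f := fun (f : KMap X (Metric.closedBall (0 : 𝕜) n)) (x : X) => f.toMap x)
      (fun f g h => ContinuousMap.ext (f := f.toMap) (g := g.toMap) fun x => congrFun h x)
      (continuous_pi fun x => KMap.continuous_eval x)
  exact hS.isClosed

theorem Cb.ofDisc_injective (n : ℕ) :
    Function.Injective (Cb.ofDisc n : KMap X (Metric.closedBall (0 : 𝕜) n) → Cb 𝕜 X) :=
  fun f g h => ContinuousMap.ext (f := f.toMap) (g := g.toMap) fun x =>
    Subtype.ext (congrArg (fun k : Cb 𝕜 X => k x) h)

/-- A subset of `Cb 𝕜 X` is closed if it has finitely many elements of norm at most `n`, for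
every `n`. -/
theorem Cb.isClosed_of_finite {S : Set (Cb 𝕜 X)}
    (hS : ∀ n : ℕ, {f ∈ S | ∀ x, ‖f x‖ ≤ n}.Finite) : IsClosed S := by
  have h : ∀ n : ℕ, IsClosed ((Cb.ofDisc n : KMap X (Metric.closedBall (0 : 𝕜) n) → _) ⁻¹' S) :=
    fun n => KMap.isClosed_of_finite <| Set.Finite.of_finite_image
      ((hS n).subset <| by
        rintro _ ⟨f, hf, rfl⟩
        exact ⟨hf, fun x => mem_closedBall_zero_iff.1 (f.toMap x).2⟩)
      (Cb.ofDisc_injective n).injOn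
  rw [← isOpen_compl_iff, isOpen_iSup_iff]
  exact fun n => isOpen_coinduced.2 (h n).isOpen_compl

/-- If members of the family had values of norm exceeding every `n`, each tail of such a sequence of
members would be closed, since it has only finitely many elements below any bound. By compactness
some member would lie in all the tails, and so be unbounded. -/
theorem Cb.exists_bound_of_compact {L : Type*} [TopologicalSpace L] [CompactSpace L]
    {i : L → Cb 𝕜 X} (hi : Continuous i) : ∃ C : ℝ, 0 ≤ C ∧ ∀ l x, ‖i l x‖ ≤ C := by
  by_contra! h
  have h' : ∀ n : ℕ, ∃ l, ∃ x, (n : ℝ) < ‖i l x‖ := fun n => h n n.cast_nonneg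
  choose l x hlx using h'
  have hcl : ∀ N : ℕ, IsClosed (i ⁻¹' ((fun n => i (l n)) '' Set.Ici N)) := fun N => by
    refine (Cb.isClosed_of_finite fun n => ?_).preimage hi
    refine ((Set.finite_Iio n).image fun n => i (l n)).subset ?_
    rintro _ ⟨⟨m, -, rfl⟩, hm⟩
    -- The `m`-th function exceeds `m` somewhere, so a bound by `n` forces `m < n`.
    exact ⟨m, by exact_mod_cast (hlx m).trans_le (hm (x m)), rfl⟩
  have hne : (⋂ N : ℕ, i ⁻¹' ((fun n => i (l n)) '' Set.Ici N)).Nonempty :=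
    IsCompact.nonempty_iInter_of_sequence_nonempty_isCompact_isClosed _
      (fun N => Set.preimage_mono (Set.image_mono (Set.Ici_subset_Ici.2 N.le_succ)))
      (fun N => ⟨l N, N, Set.self_mem_Ici, rfl⟩) (hcl 0).isCompact hcl
  obtain ⟨k, hk⟩ := hne
  obtain ⟨C, hC⟩ := (i k).exists_bound
  obtain ⟨N, hN⟩ := exists_nat_ge C
  obtain ⟨m, hm, hmk⟩ := Set.mem_iInter.1 hk N
  have h1 := hlx m
  have h2 : i (l m) (x m) = i k (x m) := congrArg (fun f : Cb 𝕜 X => f (x m)) hmk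
  have h3 : (N : ℝ) ≤ m := by exact_mod_cast hm
  rw [h2] at h1
  linarith [hC (x m)]

/-- The map `x ↦ (l ↦ i l x)` given by a compact family of bounded continuous functions. -/
def Cb.flip {L : Type u} [TopologicalSpace L] (i : C(L, Cb 𝕜 X)) (x : X) : C(L, 𝕜) :=
  ⟨fun l => i l x, (Cb.continuous_eval x).comp i.continuous⟩

/-- On a compact test space `K` over `X`, restriction to `K` depends continuously on the function
for the uniform topology, so evaluation is jointly continuous on `K × L`. With `L` compact,
uniformity over the family becomes convergence in the norm of `C(L, 𝕜)`. -/
theorem Cb.continuous_flip (hX : IsKSpace X) {L : Type u} [TopologicalSpace L]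
    (i : C(L, Cb 𝕜 X)) : Continuous (Cb.flip i) := by
  refine hX.continuous fun K _ _ _ p => ContinuousMap.continuous_of_continuous_uncurry _ ?_
  have h : Continuous fun l => (i l).toMap.comp p := (Cb.continuous_comp p).comp i.continuous
  exact (h.comp continuous_snd).eval continuous_fst

/-- A sequence in the mapping space converges if it converges uniformly on compact sets. -/
theorem KMap.tendsto_of_tendstoUniformly {Y : Type} [UniformSpace Y] {g : ℕ → C(X, Y)}
    {g' : C(X, Y)} (h : ∀ (L : Type u) [TopologicalSpace L] [CompactSpace L] [T2Space L]
      (i : C(L, X)), TendstoUniformly (fun n l => g n (i l)) (fun l => g' (i l)) atTop) :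
    Tendsto (fun n => KMap.mk (g n)) atTop (𝓝 (KMap.mk g')) := by
  -- A sequence with its limit is a map from a compact Hausdorff space, so its continuity survives
  -- k-ification.
  let G : OnePoint ℕ → C(X, Y) := fun z => z.elim g' g
  have hG : Continuous fun z => CO.mk (G z) := CO.continuous_of fun L _ _ _ i => by
    rw [OnePoint.continuous_iff_from_nat, ContinuousMap.tendsto_iff_tendstoUniformly]
    exact h L i
  have hG' : Continuous fun z : ULift.{u} (OnePoint ℕ) => Kify.mk (CO.mk (G z.down)) :=
    Kify.continuous_of_compact (hG.comp continuous_uliftDown)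
  exact (OnePoint.continuous_iff_from_nat _).1 (hG'.comp continuous_uliftUp)

/-- A sequence in the natural dual converges if it converges uniformly on compact families. -/
theorem NatDual.tendsto_of_tendstoUniformly {V : Type u} [AddCommGroup V] [Module 𝕜 V]
    [TopologicalSpace V] {ν : ℕ → NatDual 𝕜 V} {φ : NatDual 𝕜 V}
    (h : ∀ (L : Type u) [TopologicalSpace L] [CompactSpace L] [T2Space L] (i : C(L, V)),
      TendstoUniformly (fun n l => ν n (i l)) (fun l => φ (i l)) atTop) :
    Tendsto ν atTop (𝓝 φ) := by
  rw [(NatDual.isClosedEmbedding_toKMap (𝕜 := 𝕜) (V := V)).isInducing.tendsto_nhds_iff]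
  exact KMap.tendsto_of_tendstoUniformly (g := fun n => ⟨ν n, map_continuous (ν n)⟩)
    (g' := ⟨φ, map_continuous φ⟩) h

/-- A uniformly bounded sequence of continuous functions that converges uniformly on compact sets
converges in `Cb 𝕜 X`. -/
theorem Cb.tendsto_of_tendstoUniformly {f : ℕ → Cb 𝕜 X} {f' : Cb 𝕜 X} {C : ℝ}
    (hC : ∀ n x, ‖f n x‖ ≤ C) (hC' : ∀ x, ‖f' x‖ ≤ C)
    (h : ∀ (L : Type u) [TopologicalSpace L] [CompactSpace L] [T2Space L] (i : C(L, X)),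
      TendstoUniformly (fun n l => f n (i l)) (fun l => f' (i l)) atTop) :
    Tendsto f atTop (𝓝 f') := by
  obtain ⟨N, hN⟩ := exists_nat_ge C
  let g : ∀ k : Cb 𝕜 X, (∀ x, ‖k x‖ ≤ C) → C(X, Metric.closedBall (0 : 𝕜) N) := fun k hk =>
    ⟨fun x => ⟨k x, mem_closedBall_zero_iff.2 ((hk x).trans hN)⟩,
      k.toMap.continuous.subtype_mk _⟩
  have h1 : Tendsto (fun n => KMap.mk (g (f n) (hC n))) atTop (𝓝 (KMap.mk (g f' hC'))) := by
    refine KMap.tendsto_of_tendstoUniformly fun L _ _ _ i => ?_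
    rw [Metric.tendstoUniformly_iff]
    intro ε hε
    filter_upwards [Metric.tendstoUniformly_iff.1 (h L i) ε hε] with n hn l
    exact hn l
  exact ((Cb.continuous_ofDisc N).tendsto _).comp h1

end CompactFamilies

/-! ### Functionals dominated by a finite measure -/

section Dominated

open Filter

variable {𝕜 : Type} [RCLike 𝕜] {X : Type u} [TopologicalSpace X] [MeasurableSpace X]

theorem Cb.integrable [OpensMeasurableSpace X] (m : Measure X) [IsFiniteMeasure m] (f : Cb 𝕜 X) :
    Integrable f m :=
  BoundedContinuousFunction.integrable m (show X →ᵇ 𝕜 from f)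

/-- Approximation of the identity of a separable metrizable space by simple functions. -/
theorem exists_simpleFunc_tendsto_id [PolishSpace X] [BorelSpace X] [Nonempty X] :
    ∃ s : ℕ → SimpleFunc X X, ∀ x, Tendsto (fun n => s n x) atTop (𝓝 x) := by
  let := TopologicalSpace.upgradeIsCompletelyMetrizable X
  obtain ⟨x₀⟩ := ‹Nonempty X›
  exact ⟨fun n => SimpleFunc.approxOn id measurable_id Set.univ x₀ trivial n, fun x =>
    SimpleFunc.tendsto_approxOn measurable_id (Set.mem_univ x₀) (by simp)⟩

/-- Dominated convergence. The target may be inseparable, as `C(L, 𝕜)` can be: `G` is still strongly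
measurable because `X` is second countable, and `G ∘ s n` because it takes finitely many values. -/
theorem tendsto_integral_norm_sub_comp_simpleFunc [PolishSpace X] [BorelSpace X] {E : Type*}
    [NormedAddCommGroup E] (m : Measure X) [IsFiniteMeasure m]
    {s : ℕ → SimpleFunc X X} (hs : ∀ x, Tendsto (fun n => s n x) atTop (𝓝 x))
    {G : X → E} (hG : Continuous G) {C : ℝ} (hC : ∀ x, ‖G x‖ ≤ C) :
    Tendsto (fun n => ∫ x, ‖G x - G (s n x)‖ ∂m) atTop (𝓝 0) := by
  have hmeas : ∀ n, AEStronglyMeasurable (fun x => ‖G x - G (s n x)‖) m := fun n =>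
    (hG.aestronglyMeasurable.sub
      ((s n).map G).stronglyMeasurable.aestronglyMeasurable).norm
  have h := tendsto_integral_of_dominated_convergence (μ := m)
    (F := fun n x => ‖G x - G (s n x)‖) (f := fun _ => 0) (fun _ => C + C) hmeas
    (integrable_const _)
    (fun n => ae_of_all _ fun x => by
      rw [norm_norm]
      exact (norm_sub_le _ _).trans (add_le_add (hC _) (hC _)))
    (ae_of_all _ fun x => by
      have h1 := (tendsto_const_nhds (x := G x)).sub ((hG.tendsto x).comp (hs x))
      simpa using h1.norm)
  simpa using h

/-- A functional on integrable functions that is dominated by a finite measure on a Polish space is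
continuous on bounded continuous functions, and in the closed span of the Dirac functionals. -/
theorem exists_mem_measFunctionals_of_dominated [PolishSpace X] [BorelSpace X] (m : Measure X)
    [IsFiniteMeasure m] (I : (X → 𝕜) → 𝕜) (w : Set X → 𝕜)
    (hadd : ∀ f g, Integrable f m → Integrable g m → I (f + g) = I f + I g)
    (hind : ∀ A c, MeasurableSet A → I (A.indicator fun _ => c) = c * w A)
    (hnorm : ∀ f, Integrable f m → ‖I f‖ ≤ ∫ x, ‖f x‖ ∂m) :
    ∃ φ ∈ measFunctionals 𝕜 X, ∀ f : Cb 𝕜 X, φ f = I f := by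
  rcases isEmpty_or_nonempty X with hX | hX
  · refine ⟨0, zero_mem_measFunctionals, fun f => ?_⟩
    have h := hnorm f (f.integrable m)
    rw [Measure.eq_zero_of_isEmpty m] at h
    simp only [integral_zero_measure, norm_le_zero_iff] at h
    exact h.symm
  have h0 : I 0 = 0 := by
    have h := hind ∅ 0 .empty
    rwa [Set.indicator_empty, zero_mul] at h
  have hneg : ∀ f, Integrable f m → I (-f) = -I f := fun f hf => by
    have h1 := hadd f (-f) hf hf.neg
    rw [add_neg_cancel, h0] at h1
    exact (neg_eq_of_add_eq_zero_right h1.symm).symm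
  have hsub : ∀ f g, Integrable f m → Integrable g m → I f - I g = I (f - g) := fun f g hf hg => by
    rw [sub_eq_add_neg f, hadd _ _ hf hg.neg, hneg _ hg, sub_eq_add_neg]
  obtain ⟨s, hs⟩ := exists_simpleFunc_tendsto_id (X := X)
  -- Discretisation along `s n`: each value is weighted by its fibre, so that `ν n f` is `I (f ∘ s
  -- n)`.
  let ν : ℕ → NatDual 𝕜 (Cb 𝕜 X) := fun n =>
    ∑ y ∈ (s n).range, w (s n ⁻¹' {y}) • diracFunctional 𝕜 y
  have hν : ∀ n (f : Cb 𝕜 X), ν n f = ∑ y ∈ (s n).range, f y * w (s n ⁻¹' {y}) := fun n f => by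
    have h : ∀ T : Finset X, (∑ y ∈ T, w (s n ⁻¹' {y}) • diracFunctional 𝕜 y :
        NatDual 𝕜 (Cb 𝕜 X)) f = ∑ y ∈ T, f y * w (s n ⁻¹' {y}) := fun T => by
      classical
      induction T using Finset.induction_on with
      | empty => rfl
      | insert y T hy ih =>
        rw [Finset.sum_insert hy, Finset.sum_insert hy, NatDual.add_apply, ih,
          NatDual.smul_apply, diracFunctional_apply, mul_comm]
    exact h _
  have hInt : ∀ n (f : Cb 𝕜 X), Integrable (fun x => f (s n x)) m := fun n f =>
    SimpleFunc.integrable_of_isFiniteMeasure ((s n).map f)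
  have hI : ∀ n (f : Cb 𝕜 X), I (fun x => f (s n x)) = ν n f := fun n f => by
    have h : ∀ T : Finset X, I (∑ y ∈ T, (s n ⁻¹' {y}).indicator fun _ => f y) =
        ∑ y ∈ T, f y * w (s n ⁻¹' {y}) := fun T => by
      classical
      induction T using Finset.induction_on with
      | empty => exact h0
      | insert y T hy ih =>
        rw [Finset.sum_insert hy, Finset.sum_insert hy, hadd, ih,
          hind _ _ ((s n).measurableSet_fiber y)]
        · exact (integrable_const _).indicator ((s n).measurableSet_fiber y)
        · exact integrable_finsetSum' _ fun z _ =>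
            (integrable_const _).indicator ((s n).measurableSet_fiber z)
    rw [hν, ← h]
    congr 1
    ext x
    rw [Finset.sum_apply, Finset.sum_eq_single_of_mem (s n x) ((s n).mem_range_self x)]
    · simp
    · intro y _ hy
      exact Set.indicator_of_notMem (fun hx => hy hx.symm) _
  have hbound : ∀ n (f : Cb 𝕜 X), ‖I f - ν n f‖ ≤ ∫ x, ‖f x - f (s n x)‖ ∂m := fun n f => by
    rw [← hI, hsub _ _ (f.integrable m) (hInt n f)]
    exact hnorm _ ((f.integrable m).sub (hInt n f))
  have hunif : ∀ (L : Type u) [TopologicalSpace L] [CompactSpace L] [T2Space L]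
      (i : C(L, Cb 𝕜 X)),
      TendstoUniformly (fun n l => ν n (i l)) (fun l => I (i l)) atTop := by
    intro L _ _ _ i
    obtain ⟨C, hC0, hC⟩ := Cb.exists_bound_of_compact i.continuous
    have hG := Cb.continuous_flip IsHKSpace.of_polishSpace.isKSpace i
    have hlim := tendsto_integral_norm_sub_comp_simpleFunc m hs hG (C := C) fun x =>
      (ContinuousMap.norm_le _ hC0).2 fun l => hC l x
    rw [Metric.tendstoUniformly_iff]
    intro ε hε
    filter_upwards [hlim.eventually_lt_const hε] with n hn l
    rw [dist_eq_norm]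
    refine ((hbound n (i l)).trans ?_).trans_lt hn
    -- The supremum norm over `L` dominates the error for each `l`, so the bound no longer depends
    -- on `l`.
    refine integral_mono_of_nonneg (ae_of_all _ fun x => norm_nonneg _) ?_
      (ae_of_all _ fun x => (Cb.flip i x - Cb.flip i (s n x)).norm_coe_le_norm l)
    refine (Integrable.sub (Integrable.of_bound hG.aestronglyMeasurable C (ae_of_all _ fun x =>
      (ContinuousMap.norm_le _ hC0).2 fun l => hC l x)) ?_).norm
    exact SimpleFunc.integrable_of_isFiniteMeasure ((s n).map (Cb.flip i))
  -- A single function is a compact family indexed by a point.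
  have hlim : ∀ f : Cb 𝕜 X, Tendsto (fun n => ν n f) atTop (𝓝 (I f)) := fun f =>
    (hunif PUnit (ContinuousMap.const _ f)).tendsto_at PUnit.unit
  let φ : NatDual 𝕜 (Cb 𝕜 X) := (⟨⟨⟨fun f => I f, fun f g => ?_⟩, fun c f => ?_⟩, ?_⟩ :
    Cb 𝕜 X →L[𝕜] 𝕜)
  · refine ⟨φ, ?_, fun f => rfl⟩
    refine mem_closure_of_tendsto (NatDual.tendsto_of_tendstoUniformly (φ := φ) hunif)
      (Eventually.of_forall fun n => ?_)
    exact Submodule.sum_mem _ fun y _ => Submodule.smul_mem _ _ (Submodule.subset_span ⟨y, rfl⟩)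
  · exact hadd _ _ (f.integrable m) (g.integrable m)
  -- Homogeneity of `I` is not among the hypotheses; it passes to the limit from the linear
  -- functionals `ν n`.
  · refine tendsto_nhds_unique (hlim (c • f)) ?_
    simp only [map_smul]
    exact (hlim f).const_smul c
  · refine Cb.continuous_of_compact fun L _ _ _ i => ?_
    exact (hunif L i).continuous (Frequently.of_forall fun n =>
      (map_continuous (ν n)).comp i.continuous)

end Dominated

/-! ### Baire, Radon and k-regular measures on Polish spaces -/

section PolishMeasures

variable {𝕜 : Type} [RCLike 𝕜] {X : Type u} [TopologicalSpace X]

/-- In a metric space an open set is where the distance to its complement does not vanish. -/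
theorem baire_eq_borel (X : Type u) [TopologicalSpace X] [TopologicalSpace.MetrizableSpace X] :
    baire X = borel X := by
  refine le_antisymm (iSup_le fun f => ?_) (MeasurableSpace.generateFrom_le fun U hU => ?_)
  · borelize X
    borelize ℝ
    exact f.continuous.measurable.comap_le
  · let := TopologicalSpace.metrizableSpaceMetric X
    -- The distance to the empty set is `0` by convention, so the whole space is treated apart.
    rcases Set.eq_empty_or_nonempty Uᶜ with h | h
    · rw [Set.compl_empty_iff.1 h]
      exact @MeasurableSet.univ X (baire X)
    let f : C(X, ℝ) := ⟨fun x => Metric.infDist x Uᶜ, Metric.continuous_infDist_pt _⟩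
    have e : U = f ⁻¹' {0}ᶜ := by
      ext x
      have h1 := (hU.isClosed_compl).mem_iff_infDist_zero h (x := x)
      simp only [Set.mem_compl_iff] at h1
      simp only [Set.mem_preimage, Set.mem_compl_iff, Set.mem_singleton_iff]
      exact (not_iff_comm.1 h1).symm
    refine MeasurableSpace.le_def.1
      (le_iSup (fun f : C(X, ℝ) => (borel ℝ).comap f) f) U ⟨{0}ᶜ, ?_, e.symm⟩
    borelize ℝ
    exact (measurableSet_singleton (0 : ℝ)).compl

theorem isRadonMeasure_of_polishSpace [PolishSpace X] (μ : @VectorMeasure X (borel X) 𝕜 _ _)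
    (hμ : IsFiniteMeasure (@VectorMeasure.variation X (borel X) 𝕜 _ _ _ μ)) :
    IsRadonMeasure μ := by
  borelize X
  intro ε hε
  -- Ulam's theorem: a finite Borel measure on a Polish space, here the variation, is tight. Halving
  -- `ε` makes the inequality strict.
  obtain ⟨K, hK, h⟩ := isTightMeasureSet_iff_exists_isCompact_measure_compl_le.1
    (isTightMeasureSet_singleton (μ := μ.variation)) (ENNReal.ofReal (ε / 2)) (by simpa using hε)
  exact ⟨K, hK, (h _ rfl).trans_lt ((ENNReal.ofReal_lt_ofReal_iff hε).2 (by linarith))⟩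

/-- The integral is dominated by the variation, because multiplication on `𝕜` has norm at most `1`.
-/
theorem exists_mem_measFunctionals_eq_vectorMeasure_integral [PolishSpace X] [MeasurableSpace X]
    [BorelSpace X] (μ : VectorMeasure X 𝕜) [IsFiniteMeasure μ.variation] :
    ∃ φ ∈ measFunctionals 𝕜 X, ∀ f : Cb 𝕜 X,
      φ f = μ.integral f (ContinuousLinearMap.mul ℝ 𝕜) := by
  refine exists_mem_measFunctionals_of_dominated μ.variation
    (fun f => μ.integral f (ContinuousLinearMap.mul ℝ 𝕜)) μ
    (fun f g hf hg => VectorMeasure.integral_add hf hg)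
    (fun A c hA => VectorMeasure.integral_indicator_const c hA) fun f _ => ?_
  refine VectorMeasure.norm_integral_le_integral_norm.trans ?_
  exact mul_le_of_le_one_left (integral_nonneg fun _ => norm_nonneg _)
    (ContinuousLinearMap.opNorm_mul_le ℝ 𝕜)

theorem isKRegular_of_polishSpace [PolishSpace X] (μ : @VectorMeasure X (baire X) 𝕜 _ _)
    (hμ : IsFiniteMeasure (@VectorMeasure.variation X (baire X) 𝕜 _ _ _ μ)) :
    IsKRegular μ := by
  let := baire X
  have : BorelSpace X := ⟨baire_eq_borel X⟩
  obtain ⟨φ, hφ, h⟩ := exists_mem_measFunctionals_eq_vectorMeasure_integral μ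
  exact ⟨(map_continuous φ).congr h, φ, hφ, h⟩

/-- Integration against a finite measure on a Polish space belongs to `M(X)`. -/
theorem exists_mem_measFunctionals_eq_integral [PolishSpace X] [MeasurableSpace X]
    [BorelSpace X] (μ : Measure X) [IsFiniteMeasure μ] :
    ∃ φ ∈ measFunctionals 𝕜 X, ∀ f : Cb 𝕜 X, φ f = ∫ x, f x ∂μ := by
  refine exists_mem_measFunctionals_of_dominated μ (fun f => ∫ x, f x ∂μ)
    (fun A => ((μ.real A : ℝ) : 𝕜)) (fun f g hf hg => integral_add hf hg)
    (fun A c hA => ?_) fun f _ => norm_integral_le_integral_norm f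
  rw [integral_indicator_const c hA, RCLike.real_smul_eq_coe_mul, mul_comm]

end PolishMeasures

/-! ### Daniell functionals on bounded continuous functions of a Polish space -/

section Daniell

open Filter

/-- Lipschitz regularisation: the infimum over `x` of `f x + n * dist z (j x)` is `n`-Lipschitz on
all of `Z`, increases with `n` and lies below `f` on `X`. It makes a function on `X` accessible from
continuous functions on `Z`, although `f` itself need not extend. -/
theorem exists_monotone_continuousMap_tendsto {X Z : Type*} [TopologicalSpace X]
    [PseudoMetricSpace Z] [Nonempty X] {j : X → Z} (hj : IsInducing j) (f : X →ᵇ ℝ) :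
    ∃ g : ℕ → C(Z, ℝ), (∀ x, Monotone fun n => g n (j x)) ∧
      ∀ x, Tendsto (fun n => g n (j x)) atTop (𝓝 (f x)) := by
  have hf : ∀ x, -‖f‖ ≤ f x := fun x => neg_le_of_abs_le (f.norm_coe_le_norm x)
  have hf' : ∀ x, f x ≤ ‖f‖ := fun x => le_of_abs_le (f.norm_coe_le_norm x)
  have hbdd : ∀ (n : ℕ) (z : Z), BddBelow (Set.range fun x => f x + n * dist z (j x)) :=
    fun n z => ⟨-‖f‖, by
      rintro _ ⟨x, rfl⟩
      exact (hf x).trans (le_add_of_nonneg_right (by positivity))⟩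
  have hle : ∀ (n : ℕ) (x : X), ⨅ y, (f y + n * dist (j x) (j y)) ≤ f x := fun n x =>
    (ciInf_le (hbdd n (j x)) x).trans (by simp)
  refine ⟨fun n => ⟨fun z => ⨅ x, (f x + n * dist z (j x)), ?_⟩, fun x m n hmn => ?_, fun x => ?_⟩
  · refine (LipschitzWith.of_le_add_mul n fun z w => ?_).continuous
    rw [← sub_le_iff_le_add]
    refine le_ciInf fun x => ?_
    have h1 := ciInf_le (hbdd n z) x
    have h2 : (n : ℝ) * dist z (j x) ≤ n * (dist z w + dist w (j x)) :=
      mul_le_mul_of_nonneg_left (dist_triangle z w (j x)) n.cast_nonneg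
    simp only [NNReal.coe_natCast]
    linarith
  · exact ciInf_mono (hbdd m (j x)) fun y => by gcongr
  · rw [Metric.tendsto_atTop]
    intro ε hε
    have hU : {y | f x - ε / 2 < f y} ∈ 𝓝 x :=
      f.continuous.continuousAt.eventually_const_lt (by linarith)
    rw [hj.nhds_eq_comap, (Metric.nhds_basis_ball.comap j).mem_iff] at hU
    obtain ⟨δ, hδ, hU⟩ := hU
    -- With this `N`, a point at distance at least `δ` pays a penalty of at least `2 * ‖f‖`, the
    -- largest possible oscillation of `f`; only points near `x` can lower the infimum.
    obtain ⟨N, hN⟩ := exists_nat_ge (2 * ‖f‖ / δ)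
    rw [div_le_iff₀ hδ] at hN
    refine ⟨N, fun n hn => ?_⟩
    have h1 : f x - ε / 2 ≤ ⨅ y, (f y + n * dist (j x) (j y)) := by
      refine le_ciInf fun y => ?_
      rcases lt_or_ge (dist (j y) (j x)) δ with h | h
      · have h2 : f x - ε / 2 < f y := hU h
        have h3 : 0 ≤ (n : ℝ) * dist (j x) (j y) := by positivity
        linarith
      · have h2 : (N : ℝ) * δ ≤ n * dist (j x) (j y) := by
          rw [dist_comm (j x)]
          exact mul_le_mul (by exact_mod_cast hn) h hδ.le n.cast_nonneg
        linarith [hf y, hf' x]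
    rw [Real.dist_eq, abs_lt]
    exact ⟨by simp only [ContinuousMap.coe_mk]; linarith,
      by simp only [ContinuousMap.coe_mk]; linarith [hle n x]⟩

/-- The functions `max 0 (1 - n * infDist z C)` decrease to the indicator of `C`; the empty set is
separate because `infDist` vanishes there by convention. -/
theorem exists_antitone_continuousMap_tendsto {Z : Type*} [PseudoMetricSpace Z] {C : Set Z}
    (hC : IsClosed C) : ∃ g : ℕ → C(Z, ℝ), (∀ n z, 0 ≤ g n z) ∧ (∀ n, ∀ z ∈ C, g n z = 1) ∧
      (∀ z, Antitone fun n => g n z) ∧ ∀ z ∉ C, Tendsto (fun n => g n z) atTop (𝓝 0) := by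
  rcases C.eq_empty_or_nonempty with rfl | hne
  · exact ⟨fun _ => 0, fun _ _ => le_rfl, by simp, fun z => antitone_const,
      fun _ _ => tendsto_const_nhds⟩
  refine ⟨fun n => ⟨fun z => max 0 (1 - n * Metric.infDist z C), by fun_prop⟩,
    fun n z => le_max_left _ _, fun n z hz => ?_, fun z m n hmn => ?_, fun z hz => ?_⟩
  · simp [Metric.infDist_zero_of_mem hz]
  · have : (m : ℝ) ≤ n := by exact_mod_cast hmn
    exact max_le_max le_rfl (sub_le_sub_left
      (mul_le_mul_of_nonneg_right this Metric.infDist_nonneg) _)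
  · have hd := (hC.notMem_iff_infDist_pos hne).1 hz
    obtain ⟨N, hN⟩ := exists_nat_ge (1 / Metric.infDist z C)
    rw [div_le_iff₀ hd] at hN
    refine tendsto_const_nhds.congr' ?_
    filter_upwards [eventually_ge_atTop N] with n hn
    have : (N : ℝ) * Metric.infDist z C ≤ n * Metric.infDist z C :=
      mul_le_mul_of_nonneg_right (by exact_mod_cast hn) hd.le
    exact (max_eq_left (by linarith)).symm

/-- Riesz–Markov–Kakutani; on a compact space every function has compact support. -/
theorem exists_isFiniteMeasure_integral_eq_of_compactSpace {Z : Type*} [TopologicalSpace Z]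
    [CompactSpace Z] [T2Space Z] [MeasurableSpace Z] [BorelSpace Z] (Λ : C(Z, ℝ) →ₗ[ℝ] ℝ)
    (hpos : ∀ f : C(Z, ℝ), (∀ z, 0 ≤ f z) → 0 ≤ Λ f) :
    ∃ ν : Measure Z, IsFiniteMeasure ν ∧ ∀ f : C(Z, ℝ), Λ f = ∫ z, f z ∂ν := by
  open scoped CompactlySupported in
  let Λ' : C_c(Z, ℝ) →ₚ[ℝ] ℝ :=
    { toFun := fun f => Λ f.toContinuousMap
      map_add' := fun f g => map_add Λ f.toContinuousMap g.toContinuousMap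
      map_smul' := fun c f => map_smul Λ c f.toContinuousMap
      monotone' := fun f g h => by
        have h1 := hpos (g.toContinuousMap - f.toContinuousMap) fun z => sub_nonneg.2 (h z)
        rw [map_sub] at h1
        exact sub_nonneg.1 h1 }
  refine ⟨RealRMK.rieszMeasure Λ', ⟨isCompact_univ.measure_lt_top⟩, fun f => ?_⟩
  exact (RealRMK.integral_rieszMeasure Λ' ⟨f, HasCompactSupport.of_compactSpace _⟩).symm

/-- A positive normalised functional on the bounded continuous functions on a Polish space that is
continuous along monotone sequences is the integral against a probability measure. -/
theorem exists_isProbabilityMeasure_eq_integral {X : Type*} [TopologicalSpace X] [PolishSpace X]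
    [MeasurableSpace X] [BorelSpace X] (ρ : (X →ᵇ ℝ) →ₗ[ℝ] ℝ)
    (hpos : ∀ f : X →ᵇ ℝ, (∀ x, 0 ≤ f x) → 0 ≤ ρ f) (hone : ρ 1 = 1)
    (hmono : ∀ (F : ℕ → X →ᵇ ℝ) (f : X →ᵇ ℝ), (∀ x, Monotone fun n => F n x) →
      (∀ x, Tendsto (fun n => F n x) atTop (𝓝 (f x))) →
      Tendsto (fun n => ρ (F n)) atTop (𝓝 (ρ f))) :
    ∃ μ : Measure X, IsProbabilityMeasure μ ∧ ∀ f : X →ᵇ ℝ, ρ f = ∫ x, f x ∂μ := by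
  have hX : Nonempty X := by
    by_contra hX
    rw [not_nonempty_iff] at hX
    have h : (1 : X →ᵇ ℝ) = 0 := by
      ext x
      exact hX.elim x
    rw [h, map_zero] at hone
    exact zero_ne_one hone
  obtain ⟨j, hj⟩ : ∃ j : X → ℕ → unitInterval, IsEmbedding j := by
    let := TopologicalSpace.metrizableSpaceMetric X
    exact Metric.PiNatEmbed.exists_embedding_to_hilbert_cube
  borelize (ℕ → unitInterval)
  let := TopologicalSpace.metrizableSpaceMetric (ℕ → unitInterval)
  -- Lusin–Souslin: the image of the Polish space `X` is Borel in the cube.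
  have hjm : MeasurableEmbedding j := hj.continuous.measurableEmbedding hj.injective
  let r : C(ℕ → unitInterval, ℝ) → X →ᵇ ℝ := fun g =>
    (BoundedContinuousFunction.mkOfCompact g).compContinuous ⟨j, hj.continuous⟩
  have hr : ∀ g x, r g x = g (j x) := fun g x => rfl
  obtain ⟨ν, hν, hνr⟩ := exists_isFiniteMeasure_integral_eq_of_compactSpace
    (⟨⟨fun g => ρ (r g), fun f g => map_add ρ (r f) (r g)⟩, fun c f => map_smul ρ c (r f)⟩ :
      C(ℕ → unitInterval, ℝ) →ₗ[ℝ] ℝ) fun f hf => hpos _ fun x => hf (j x)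
  replace hνr : ∀ g, ρ (r g) = ∫ z, g z ∂ν := hνr
  have hgint : ∀ g : C(ℕ → unitInterval, ℝ), Integrable g ν := fun g =>
    (BoundedContinuousFunction.mkOfCompact g).integrable ν
  -- By inner regularity it suffices to treat closed sets missing the image. Functions decreasing to
  -- the indicator of such a set decrease to `0` on `X`, and `hmono`, applied to their negatives,
  -- makes its measure zero.
  have hrange : ν (Set.range j)ᶜ = 0 := by
    rw [hjm.measurableSet_range.compl.measure_eq_iSup_isClosed_of_ne_top (measure_ne_top _ _)]
    simp only [ENNReal.iSup_eq_zero]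
    intro C hC hCc
    obtain ⟨g, hg0, hg1, hga, hgt⟩ := exists_antitone_continuousMap_tendsto hCc
    have h1 : Tendsto (fun n => ρ (-(r (g n)))) atTop (𝓝 (ρ 0)) := by
      refine hmono _ _ (fun x m n hmn => neg_le_neg (hga (j x) hmn)) fun x => ?_
      have h2 := (hgt (j x) fun hx => hC hx ⟨x, rfl⟩).neg
      rwa [neg_zero] at h2
    have h2 : Tendsto (fun n => ∫ z, g n z ∂ν) atTop (𝓝 0) := by
      simpa [map_neg, hνr] using h1.neg
    have h3 : ν.real C ≤ 0 := ge_of_tendsto' h2 fun n => by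
      rw [← integral_indicator_one hCc.measurableSet]
      refine integral_mono ((integrable_const 1).indicator hCc.measurableSet) (hgint _) fun z => ?_
      by_cases hz : z ∈ C
      · simp [hz, hg1 n z hz]
      · simp [hz, hg0 n z]
    exact (measureReal_eq_zero_iff).1 (le_antisymm h3 measureReal_nonneg)
  let μ := ν.comap j
  have hμ : μ.map j = ν := by
    rw [hjm.map_comap]
    exact Measure.restrict_eq_self_of_ae_mem (mem_ae_iff.2 hrange)
  have hμf : IsFiniteMeasure μ := ⟨by
    rw [← Set.preimage_univ (f := j), ← hjm.map_apply, hμ]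
    exact measure_lt_top ν _⟩
  have hμr : ∀ g, ρ (r g) = ∫ x, r g x ∂μ := fun g => by
    rw [hνr, ← hμ, hjm.integral_map]
    rfl
  -- Agreement is known on restrictions from the cube; monotone limits of these reach every bounded
  -- continuous function, and both sides respect such limits.
  have key : ∀ f : X →ᵇ ℝ, ρ f = ∫ x, f x ∂μ := fun f => by
    obtain ⟨g, hgm, hgt⟩ := exists_monotone_continuousMap_tendsto hj.isInducing f
    refine tendsto_nhds_unique (hmono (fun n => r (g n)) f hgm hgt) ?_
    simp only [hμr]
    exact integral_tendsto_of_tendsto_of_monotone (fun n => (r (g n)).integrable μ)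
      (f.integrable μ) (ae_of_all _ hgm) (ae_of_all _ hgt)
  refine ⟨μ, ⟨?_⟩, key⟩
  have h1 := key 1
  rw [hone] at h1
  simp only [BoundedContinuousFunction.coe_one, Pi.one_apply, integral_const, smul_eq_mul,
    mul_one] at h1
  rw [← ENNReal.toReal_eq_one_iff]
  exact h1.symm

end Daniell

/-! ### Representation of `P(X)` by Borel probability measures -/

section Representation

open Filter

variable {𝕜 : Type} [RCLike 𝕜] {X : Type u} [TopologicalSpace X]

variable (𝕜) in
/-- A bounded continuous real function, seen as a `𝕜`-valued function. -/
noncomputable def Cb.ofReal (f : X →ᵇ ℝ) : Cb 𝕜 X :=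
  Cb.mk ⟨fun x => (f x : 𝕜), RCLike.continuous_ofReal.comp f.continuous⟩ ‖f‖ fun x => by
    simpa using f.norm_coe_le_norm x

@[simp] theorem Cb.ofReal_apply (f : X →ᵇ ℝ) (x : X) : Cb.ofReal 𝕜 f x = (f x : 𝕜) := rfl

theorem ProbSpace.map_add (φ : ProbSpace 𝕜 X) (f g : Cb 𝕜 X) : φ (f + g) = φ f + φ g :=
  _root_.map_add φ.1 f g

theorem ProbSpace.map_smul (φ : ProbSpace 𝕜 X) (c : 𝕜) (f : Cb 𝕜 X) : φ (c • f) = c * φ f :=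
  _root_.map_smul φ.1 c f

/-- Adding the constant `‖f‖` makes the function nonnegative, so positivity makes the value real. -/
theorem ProbSpace.apply_ofReal (φ : ProbSpace 𝕜 X) (f : X →ᵇ ℝ) :
    φ (Cb.ofReal 𝕜 f) = (RCLike.re (φ (Cb.ofReal 𝕜 f)) : 𝕜) := by
  have h1 : 0 ≤ φ (Cb.ofReal 𝕜 f + (‖f‖ : 𝕜) • 1) := φ.nonneg fun x => by
    rw [Cb.add_apply, Cb.smul_apply, Cb.ofReal_apply, Cb.one_apply, mul_one, ← RCLike.ofReal_add]
    exact RCLike.ofReal_nonneg.2 (by linarith [neg_le_of_abs_le (f.norm_coe_le_norm x)])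
  rw [φ.map_add, φ.map_smul, φ.map_one, mul_one] at h1
  have h2 := (RCLike.nonneg_iff.1 h1).2
  simp only [_root_.map_add, RCLike.ofReal_im, add_zero] at h2
  conv_lhs => rw [← RCLike.re_add_im (φ (Cb.ofReal 𝕜 f)), h2]
  simp

/-- The real functional underlying an element of `P(X)`. -/
noncomputable def ProbSpace.reFunctional (φ : ProbSpace 𝕜 X) : (X →ᵇ ℝ) →ₗ[ℝ] ℝ where
  toFun f := RCLike.re (φ (Cb.ofReal 𝕜 f))
  map_add' f g := by
    rw [← _root_.map_add, ← φ.map_add]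
    congr 2
    ext x
    simp
  map_smul' c f := by
    have h : Cb.ofReal 𝕜 (c • f) = (c : 𝕜) • Cb.ofReal 𝕜 f := by
      ext x
      simp
    rw [h, φ.map_smul, RCLike.re_ofReal_mul]
    rfl

theorem ProbSpace.reFunctional_apply (φ : ProbSpace 𝕜 X) (f : X →ᵇ ℝ) :
    φ.reFunctional f = RCLike.re (φ (Cb.ofReal 𝕜 f)) := rfl

theorem ProbSpace.ofReal_reFunctional (φ : ProbSpace 𝕜 X) (f : X →ᵇ ℝ) :
    (φ.reFunctional f : 𝕜) = φ (Cb.ofReal 𝕜 f) := (φ.apply_ofReal f).symm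

/-- Elements of `P(X)` are continuous along monotone sequences, by Dini's theorem. -/
theorem ProbSpace.tendsto_reFunctional_of_monotone (φ : ProbSpace 𝕜 X) {F : ℕ → X →ᵇ ℝ}
    {f : X →ᵇ ℝ} (hF : ∀ x, Monotone fun n => F n x)
    (hf : ∀ x, Tendsto (fun n => F n x) atTop (𝓝 (f x))) :
    Tendsto (fun n => φ.reFunctional (F n)) atTop (𝓝 (φ.reFunctional f)) := by
  have hle : ∀ n x, F n x ≤ f x := fun n x => (hF x).ge_of_tendsto (hf x) n
  -- The sequence lies between `F 0` and `f`, so it stays in one disc, as convergence in the colimit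
  -- requires.
  have hC : ∀ n x, ‖F n x‖ ≤ max ‖F 0‖ ‖f‖ := fun n x => by
    have h1 := neg_le_of_abs_le ((F 0).norm_coe_le_norm x)
    have h2 := le_of_abs_le (f.norm_coe_le_norm x)
    have h3 : F 0 x ≤ F n x := hF x n.zero_le
    refine abs_le.2 ⟨?_, ?_⟩
    · linarith [le_max_left ‖F 0‖ ‖f‖]
    · linarith [le_max_right ‖F 0‖ ‖f‖, hle n x]
  have h : Tendsto (fun n => Cb.ofReal 𝕜 (F n)) atTop (𝓝 (Cb.ofReal 𝕜 f)) := by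
    refine Cb.tendsto_of_tendstoUniformly (C := max ‖F 0‖ ‖f‖) (fun n x => ?_) (fun x => ?_)
      fun L _ _ _ i => ?_
    · simpa using hC n x
    · simpa using Or.inr (f.norm_coe_le_norm x)
    · have h1 := Monotone.tendstoUniformly_of_forall_tendsto (F := fun n l => F n (i l))
        (f := fun l => f (i l)) (fun n => (F n).continuous.comp i.continuous)
        (fun m n hmn l => hF (i l) hmn) (f.continuous.comp i.continuous) fun l => hf (i l)
      rw [Metric.tendstoUniformly_iff] at h1 ⊢
      intro ε hε
      filter_upwards [h1 ε hε] with n hn l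
      have h2 := hn l
      rw [dist_eq_norm] at h2 ⊢
      rwa [Cb.ofReal_apply, Cb.ofReal_apply, ← RCLike.ofReal_sub, RCLike.norm_ofReal]
  exact (RCLike.continuous_re.tendsto _).comp (((map_continuous φ.1).tendsto _).comp h)

theorem Cb.eq_ofReal_add_I_smul_ofReal (f : Cb 𝕜 X) :
    ∃ g h : X →ᵇ ℝ, (∀ x, g x = RCLike.re (f x)) ∧ (∀ x, h x = RCLike.im (f x)) ∧
      f = Cb.ofReal 𝕜 g + (RCLike.I : 𝕜) • Cb.ofReal 𝕜 h := by
  obtain ⟨C, hC⟩ := f.exists_bound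
  refine ⟨BoundedContinuousFunction.ofNormedAddCommGroup (fun x => RCLike.re (f x))
    (RCLike.continuous_re.comp f.toMap.continuous) C
    fun x => (RCLike.abs_re_le_norm (f x)).trans (hC x),
    BoundedContinuousFunction.ofNormedAddCommGroup (fun x => RCLike.im (f x))
    (RCLike.continuous_im.comp f.toMap.continuous) C
    fun x => (RCLike.abs_im_le_norm (f x)).trans (hC x), fun _ => rfl, fun _ => rfl, ?_⟩
  ext x
  simpa [mul_comm] using (RCLike.re_add_im (f x)).symm

variable [MeasurableSpace X] [BorelSpace X]

theorem ProbSpace.exists_isProbabilityMeasure [PolishSpace X] (φ : ProbSpace 𝕜 X) :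
    ∃ μ : Measure X, IsProbabilityMeasure μ ∧ ∀ f : Cb 𝕜 X, φ f = ∫ x, f x ∂μ := by
  obtain ⟨μ, hμ, h⟩ := exists_isProbabilityMeasure_eq_integral φ.reFunctional
    (fun f hf => (RCLike.nonneg_iff.1 (φ.nonneg fun x => RCLike.ofReal_nonneg.2 (hf x))).1)
    (by
      rw [φ.reFunctional_apply]
      have h : Cb.ofReal 𝕜 (1 : X →ᵇ ℝ) = 1 := by
        ext x
        simp
      rw [h, φ.map_one, RCLike.one_re])
    fun F f => φ.tendsto_reFunctional_of_monotone
  refine ⟨μ, hμ, fun f => ?_⟩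
  obtain ⟨g, k, hg, hk, e⟩ := f.eq_ofReal_add_I_smul_ofReal
  rw [← integral_re_add_im (f.integrable μ), e, φ.map_add, φ.map_smul, ← φ.ofReal_reFunctional,
    ← φ.ofReal_reFunctional, h, h, ← e]
  simp only [hg, hk]
  rw [mul_comm (RCLike.I : 𝕜)]

theorem exists_probSpace_eq_integral [PolishSpace X] (μ : Measure X) [IsProbabilityMeasure μ] :
    ∃ φ : ProbSpace 𝕜 X, ∀ f : Cb 𝕜 X, φ f = ∫ x, f x ∂μ := by
  obtain ⟨φ, hφ, h⟩ := exists_mem_measFunctionals_eq_integral (𝕜 := 𝕜) μ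
  refine ⟨⟨φ, hφ, fun f hf => ?_, ?_⟩, h⟩
  · rw [h]
    exact integral_nonneg hf
  · rw [h]
    simp

/-- Integrals of a compact family of bounded continuous functions converge uniformly along weakly
convergent sequences. -/
theorem tendstoUniformly_integral_of_compact [PolishSpace X] {μ : ℕ → ProbabilityMeasure X}
    {μ' : ProbabilityMeasure X} (hμ : Tendsto μ atTop (𝓝 μ')) {L : Type u} [TopologicalSpace L]
    [CompactSpace L] (i : C(L, Cb 𝕜 X)) :
    TendstoUniformly (fun n l => ∫ x, i l x ∂(μ n : Measure X))
      (fun l => ∫ x, i l x ∂(μ' : Measure X)) atTop := by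
  obtain ⟨C, hC0, hC⟩ := Cb.exists_bound_of_compact i.continuous
  -- The converse half of Prokhorov's theorem: a convergent sequence with its limit is compact,
  -- hence tight.
  have htight : IsTightMeasureSet
      {((ν : ProbabilityMeasure X) : Measure X) | ν ∈ insert μ' (Set.range μ)} := by
    let := TopologicalSpace.upgradeIsCompletelyMetrizable X
    refine isTightMeasureSet_of_isCompact_closure ?_
    rw [hμ.isCompact_insert_range.isClosed.closure_eq]
    exact hμ.isCompact_insert_range
  rw [isTightMeasureSet_iff_exists_isCompact_measure_compl_le] at htight
  rw [← tendstoLocallyUniformly_iff_tendstoUniformly_of_compactSpace,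
    Metric.tendstoLocallyUniformly_iff]
  intro ε hε l₀
  -- Off a compact set of comass `δ`, two members differ by at most `2 * C`. The final budget is two
  -- fifths of `ε` for moving `l` to `l₀` under each measure, and one fifth for changing the measure
  -- at `l₀`.
  obtain ⟨δ, hδ, hδε⟩ : ∃ δ : ℝ, 0 < δ ∧ 2 * C * δ < ε / 5 := by
    refine ⟨ε / 5 / (2 * C + 1), by positivity, ?_⟩
    rw [mul_div_assoc', div_lt_iff₀ (by positivity)]
    nlinarith
  obtain ⟨K, hK, hKμ⟩ := htight (ENNReal.ofReal δ) (by simpa using hδ)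
  have : CompactSpace K := isCompact_iff_compactSpace.1 hK
  let j : C(K, X) := ⟨Subtype.val, continuous_subtype_val⟩
  have hU : {l | dist ((i l).toMap.comp j) ((i l₀).toMap.comp j) < ε / 5} ∈ 𝓝 l₀ :=
    ((Cb.continuous_comp j).comp i.continuous).continuousAt.eventually
      (Metric.ball_mem_nhds _ (by positivity))
  have key : ∀ ν ∈ insert μ' (Set.range μ), ∀ l,
      dist ((i l).toMap.comp j) ((i l₀).toMap.comp j) < ε / 5 →
      dist (∫ x, i l x ∂(ν : Measure X)) (∫ x, i l₀ x ∂(ν : Measure X)) < 2 * (ε / 5) := by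
    intro ν hν l hl
    rw [dist_eq_norm, ← integral_sub ((i l).integrable _) ((i l₀).integrable _)]
    have h1 : ∀ x, ‖i l x - i l₀ x‖ ≤ ε / 5 + Kᶜ.indicator (fun _ => 2 * C) x := fun x => by
      by_cases hx : x ∈ K
      · rw [Set.indicator_of_notMem (by simpa using hx), add_zero, ← dist_eq_norm]
        exact (ContinuousMap.dist_apply_le_dist (f := (i l).toMap.comp j)
          (g := (i l₀).toMap.comp j) ⟨x, hx⟩).trans hl.le
      · rw [Set.indicator_of_mem (by simpa using hx)]
        linarith [norm_sub_le (i l x) (i l₀ x), hC l x, hC l₀ x]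
    have hKm : MeasurableSet Kᶜ := hK.measurableSet.compl
    have h2 : (ν : Measure X).real Kᶜ ≤ δ :=
      ENNReal.toReal_le_of_le_ofReal hδ.le (hKμ _ ⟨ν, hν, rfl⟩)
    have h3 := norm_integral_le_of_norm_le (μ := (ν : Measure X))
      ((integrable_const (ε / 5)).add ((integrable_const (2 * C)).indicator hKm))
      (ae_of_all _ h1)
    rw [integral_add' (integrable_const _) ((integrable_const _).indicator hKm),
      integral_indicator_const _ hKm, integral_const] at h3
    simp only [probReal_univ, smul_eq_mul, one_mul] at h3
    have h4 : (ν : Measure X).real Kᶜ * (2 * C) ≤ δ * (2 * C) :=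
      mul_le_mul_of_nonneg_right h2 (by positivity)
    linarith
  refine ⟨_, hU, ?_⟩
  have hlim := (ProbabilityMeasure.tendsto_iff_forall_integral_rclike_tendsto 𝕜).1 hμ (i l₀)
  filter_upwards [Metric.tendsto_nhds.1 hlim (ε / 5) (by positivity)] with n hn l hl
  have h1 := key μ' (Set.mem_insert _ _) l hl
  have h2 := key (μ n) (Set.mem_insert_of_mem _ ⟨n, rfl⟩) l hl
  rw [dist_comm] at h2
  have h3 : dist (∫ x, i l₀ x ∂(μ n : Measure X)) (∫ x, i l₀ x ∂(μ' : Measure X)) < ε / 5 := hn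
  rw [dist_comm] at h3
  have h4 := dist_triangle4 (∫ x, i l x ∂(μ' : Measure X)) (∫ x, i l₀ x ∂(μ' : Measure X))
    (∫ x, i l₀ x ∂(μ n : Measure X)) (∫ x, i l x ∂(μ n : Measure X))
  linarith

end Representation

/-! ### The homeomorphism between `P(X)` and the weak topology on measures -/

section Homeomorphism

open Filter

attribute [local instance] borel borelSpace_borel

variable {𝕜 : Type} [RCLike 𝕜] {X : Type u} [TopologicalSpace X]

/-- A bounded continuous nonnegative function, seen as a real function. -/
noncomputable def BoundedContinuousFunction.coeNNReal (f : X →ᵇ NNReal) : X →ᵇ ℝ :=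
  BoundedContinuousFunction.comp _ (NNReal.isometry_coe.lipschitz) f

theorem BorelProb.ext_of_integral [HasOuterApproxClosed X] {μ ν : BorelProb X}
    (h : ∀ f : Cb 𝕜 X, ∫ x, f x ∂μ.toMeasure = ∫ x, f x ∂ν.toMeasure) : μ = ν := by
  refine ProbabilityMeasure.toMeasure_injective (Ω := X)
    (ext_of_forall_integral_eq_of_IsFiniteMeasure (μ := μ.toMeasure) (ν := ν.toMeasure)
      fun f => ?_)
  have h1 := h (Cb.ofReal 𝕜 f)
  simp only [Cb.ofReal_apply, integral_ofReal] at h1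
  exact RCLike.ofReal_inj.1 h1

/-- Passes from `𝕜`-valued integrals, which describe functionals, to the lower integrals that test
the weak topology. -/
theorem BorelProb.lintegral_eq_ofReal_apply {φ : ProbSpace 𝕜 X} {μ : BorelProb X}
    (h : ∀ f : Cb 𝕜 X, φ f = ∫ x, f x ∂μ.toMeasure) (f : X →ᵇ NNReal) :
    ∫⁻ x, f x ∂μ.toMeasure = ENNReal.ofReal (RCLike.re (φ (Cb.ofReal 𝕜 f.coeNNReal))) := by
  rw [h]
  simp only [Cb.ofReal_apply, integral_ofReal, RCLike.ofReal_re]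
  rw [ofReal_integral_eq_lintegral_ofReal (f.coeNNReal.integrable _)
    (ae_of_all _ fun x => NNReal.coe_nonneg _)]
  exact lintegral_congr fun x => (ENNReal.ofReal_coe_nnreal).symm

instance [PolishSpace X] : TopologicalSpace.MetrizableSpace (BorelProb X) :=
  inferInstanceAs (TopologicalSpace.MetrizableSpace (ProbabilityMeasure X))

variable (𝕜 X) in
theorem exists_homeomorph_borelProb [PolishSpace X] :
    ∃ e : ProbSpace 𝕜 X ≃ₜ BorelProb X,
      ∀ (φ : ProbSpace 𝕜 X) (f : Cb 𝕜 X), φ f = ∫ x, f x ∂(e φ).toMeasure := by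
  have h1 : ∀ φ : ProbSpace 𝕜 X, ∃ μ : BorelProb X, ∀ f : Cb 𝕜 X, φ f = ∫ x, f x ∂μ.toMeasure :=
    fun φ => by
      obtain ⟨μ, hμ, h⟩ := φ.exists_isProbabilityMeasure
      exact ⟨⟨μ, hμ⟩, h⟩
  choose e he using h1
  have h2 : ∀ μ : BorelProb X, ∃ φ : ProbSpace 𝕜 X, ∀ f : Cb 𝕜 X, φ f = ∫ x, f x ∂μ.toMeasure :=
    fun μ => exists_probSpace_eq_integral μ.toMeasure
  choose e' he' using h2
  refine ⟨⟨⟨e, e', fun φ => ProbSpace.ext fun f => (he' _ f).trans (he φ f).symm,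
    fun μ => BorelProb.ext_of_integral (𝕜 := 𝕜) fun f => (he _ f).symm.trans (he' μ f)⟩,
    ?_, ?_⟩, he⟩
  · refine BorelProb.continuous_of fun f => ?_
    simp only [fun φ => BorelProb.lintegral_eq_ofReal_apply (he φ) f]
    exact ENNReal.continuous_ofReal.comp
      (RCLike.continuous_re.comp (ProbSpace.continuous_eval _))
  -- Sequences suffice because the weak topology is metrizable, and on sequences the natural dual
  -- only asks for uniform convergence on compact families.
  · refine SeqContinuous.continuous fun μ μ' hμ => ?_
    refine tendsto_subtype_rng.2 (NatDual.tendsto_of_tendstoUniformly fun L _ _ _ i => ?_)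
    have h := tendstoUniformly_integral_of_compact (X := X) hμ i
    convert h using 3 with n
    · exact he' (μ n) _
    · exact he' μ' _

end Homeomorphism

/-! ### The space of probability measures on a Polish space is Polish -/

section PolishProbability

open Filter

/-- Pushforward into the Hilbert cube injects the measures on `X` into a compact metrizable space.
Its range is separable, and the inverse `s` on the range is a continuous surjection. -/
theorem separableSpace_probabilityMeasure {X : Type*} [TopologicalSpace X] [PolishSpace X]
    [MeasurableSpace X] [BorelSpace X] :
    TopologicalSpace.SeparableSpace (ProbabilityMeasure X) := by
  rcases isEmpty_or_nonempty X with hX | hX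
  · have : IsEmpty (ProbabilityMeasure X) := ⟨fun μ => by
      have h := measure_univ (μ := (μ : Measure X))
      rw [Measure.eq_zero_of_isEmpty (μ : Measure X)] at h
      simp at h⟩
    infer_instance
  obtain ⟨j, hj⟩ : ∃ j : X → ℕ → unitInterval, IsEmbedding j := by
    let := TopologicalSpace.metrizableSpaceMetric X
    exact Metric.PiNatEmbed.exists_embedding_to_hilbert_cube
  borelize (ℕ → unitInterval)
  have hjm : MeasurableEmbedding j := hj.continuous.measurableEmbedding hj.injective
  let F : ProbabilityMeasure X → ProbabilityMeasure (ℕ → unitInterval) := fun μ =>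
    μ.map hj.continuous.measurable.aemeasurable
  have hF : ∀ μ (U : Set (ℕ → unitInterval)), IsOpen U →
      (F μ : Measure (ℕ → unitInterval)) U = (μ : Measure X) (j ⁻¹' U) := fun μ U hU =>
    hjm.map_apply _ _
  have hsec : SecondCountableTopology (ProbabilityMeasure (ℕ → unitInterval)) := by
    let := TopologicalSpace.metrizableSpaceMetric (ProbabilityMeasure (ℕ → unitInterval))
    infer_instance
  let s : Set.range F → ProbabilityMeasure X := fun ν => ν.2.choose
  have hs : ∀ ν, F (s ν) = ν := fun ν => ν.2.choose_spec
  have hFinj : Function.Injective F := fun μ μ' h => by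
    refine ProbabilityMeasure.toMeasure_injective (hjm.map_injective ?_)
    exact congrArg ProbabilityMeasure.toMeasure h
  have hsc : Continuous s := by
    refine SeqContinuous.continuous fun ν ν' hν => ?_
    -- The portmanteau criterion suits embeddings: open sets of `X` are traces of open sets of the
    -- cube, with the same mass.
    refine tendsto_of_forall_isOpen_le_liminf_nat' fun G hG => ?_
    obtain ⟨U, hU, rfl⟩ := hj.isInducing.isOpen_iff.1 hG
    simp only [Function.comp_apply, ← hF _ U hU, hs]
    exact ProbabilityMeasure.le_liminf_measure_open_of_tendsto
      (((continuous_subtype_val.tendsto _).comp hν)) hU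
  refine Function.Surjective.denseRange (f := s) (fun μ => ⟨⟨F μ, μ, rfl⟩, hFinj (hs _)⟩)
    |>.separableSpace hsc

/-- Intersecting finite unions of closed balls of radii tending to `0` gives a closed, totally
bounded set, compact by completeness. The errors are chosen summable to less than `ε`. -/
theorem isTightMeasureSet_of_forall_exists_finite {X : Type*} [PseudoMetricSpace X]
    [CompleteSpace X] [MeasurableSpace X] {S : Set (Measure X)}
    (h : ∀ δ : ENNReal, 0 < δ → ∀ r : ℝ, 0 < r → ∃ F : Set X, F.Finite ∧
      ∀ μ ∈ S, μ (⋃ x ∈ F, Metric.closedBall x r)ᶜ ≤ δ) : IsTightMeasureSet S := by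
  rw [isTightMeasureSet_iff_exists_isCompact_measure_compl_le]
  intro ε hε
  obtain ⟨δ, hδ, hδε⟩ := ENNReal.exists_pos_sum_of_countable hε.ne' ℕ
  have h' : ∀ k : ℕ, ∃ F : Set X, F.Finite ∧
      ∀ μ ∈ S, μ (⋃ x ∈ F, Metric.closedBall x (1 / (k + 1 : ℝ)))ᶜ ≤ δ k := fun k =>
    h (δ k) (ENNReal.coe_pos.2 (hδ k)) _ (by positivity)
  choose F hF hFμ using h'
  refine ⟨⋂ k, ⋃ x ∈ F k, Metric.closedBall x (1 / (k + 1 : ℝ)),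
    TotallyBounded.isCompact_of_isClosed ?_ ?_, fun μ hμ => ?_⟩
  · refine Metric.totallyBounded_iff.2 fun ε hε => ?_
    obtain ⟨k, hk⟩ := exists_nat_one_div_lt hε
    exact ⟨F k, hF k, (Set.iInter_subset _ k).trans
      (Set.iUnion₂_mono fun x _ => Metric.closedBall_subset_ball hk)⟩
  · exact isClosed_iInter fun k => (hF k).isClosed_biUnion fun x _ => Metric.isClosed_closedBall
  · rw [Set.compl_iInter]
    exact (measure_iUnion_le _).trans ((ENNReal.tsum_le_tsum fun k => hFμ k μ hμ).trans hδε.le)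

/-- The Lévy–Prokhorov metric of a complete separable metric space is complete. -/
theorem completeSpace_levyProkhorov {X : Type*} [MetricSpace X]
    [CompleteSpace X] [SecondCountableTopology X] [MeasurableSpace X] [BorelSpace X] :
    CompleteSpace (LevyProkhorov (ProbabilityMeasure X)) := by
  refine Metric.complete_of_cauchySeq_tendsto fun v hv => ?_
  have htight : IsTightMeasureSet {((μ : ProbabilityMeasure X) : Measure X) |
      μ ∈ Set.range fun n => (v n).toMeasure} := by
    refine isTightMeasureSet_of_forall_exists_finite fun δ hδ r hr => ?_
    -- The factors `2` count two losses: in mass, from the compact set and from the Lévy–Prokhorov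
    -- distance; in radius, from the cover and from the thickening.
    obtain ⟨c, hc, hcδ, hcr⟩ : ∃ c : ℝ, 0 < c ∧ 2 * ENNReal.ofReal c ≤ δ ∧ 2 * c ≤ r := by
      rcases eq_or_ne δ ⊤ with rfl | hδ'
      · exact ⟨r / 2, by positivity, le_top, by linarith⟩
      · have hδ0 := ENNReal.toReal_pos hδ.ne' hδ'
        refine ⟨min (r / 2) (δ.toReal / 2), by positivity, ?_, ?_⟩
        · rw [← ENNReal.ofReal_ofNat 2, ← ENNReal.ofReal_mul zero_le_two]
          refine ENNReal.ofReal_le_of_le_toReal ?_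
          linarith [min_le_right (r / 2) (δ.toReal / 2)]
        · linarith [min_le_left (r / 2) (δ.toReal / 2)]
    obtain ⟨N, hN⟩ := EMetric.cauchySeq_iff'.1 hv (ENNReal.ofReal c) (by simpa using hc)
    have hK : ∀ n, ∃ K : Set X, IsCompact K ∧
        ((v n).toMeasure : Measure X) Kᶜ ≤ ENNReal.ofReal c := fun n => by
      obtain ⟨K, hK, h⟩ := isTightMeasureSet_iff_exists_isCompact_measure_compl_le.1
        (isTightMeasureSet_singleton (μ := ((v n).toMeasure : Measure X))) (ENNReal.ofReal c)
        (by simpa using hc)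
      exact ⟨K, hK, h _ rfl⟩
    choose K hK hKv using hK
    have hKN : IsCompact (⋃ n ∈ Set.Iic N, K n) :=
      (Set.finite_Iic N).isCompact_biUnion fun n _ => hK n
    obtain ⟨F, -, hF, hFK⟩ := hKN.finite_cover_balls hc
    -- A point of `K n` is within `c` of `F`, so everything within `c` of it stays in the balls of
    -- radius `r ≥ 2 * c`.
    have hsub : ∀ n ≤ N, Metric.thickening c (⋃ x ∈ F, Metric.closedBall x r)ᶜ ⊆ (K n)ᶜ := by
      intro n hn y hy hyK
      obtain ⟨x, hx, hyx⟩ := Set.mem_iUnion₂.1 (hFK (Set.mem_biUnion (Set.mem_Iic.2 hn) hyK))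
      obtain ⟨z, hz, hyz⟩ := Metric.mem_thickening_iff.1 hy
      refine hz (Set.mem_biUnion hx ?_)
      rw [Metric.mem_closedBall]
      rw [Metric.mem_ball] at hyx
      rw [dist_comm] at hyz
      linarith [dist_triangle z y x]
    refine ⟨F, hF, ?_⟩
    rintro _ ⟨_, ⟨n, rfl⟩, rfl⟩
    refine le_trans ?_ hcδ
    rcases le_or_gt n N with hn | hn
    · refine (measure_mono ((Metric.self_subset_thickening hc _).trans (hsub n hn))).trans ?_
      refine (hKv n).trans ?_
      rw [two_mul]
      exact le_self_add
    -- Beyond `N`, all measures are within `c` of the `N`-th one, so its compact set controls them.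
    · have hd := hN n hn.le
      rw [LevyProkhorov.edist_probabilityMeasure_def] at hd
      have h1 := left_measure_le_of_levyProkhorovEDist_lt hd
        (B := (⋃ x ∈ F, Metric.closedBall x r)ᶜ)
        (hF.isClosed_biUnion fun x _ => Metric.isClosed_closedBall).measurableSet.compl
      rw [ENNReal.toReal_ofReal hc.le] at h1
      refine h1.trans ?_
      rw [two_mul]
      gcongr
      exact (measure_mono (hsub N le_rfl)).trans (hKv N)
  -- Prokhorov's theorem gives a convergent subsequence, which suffices for a Cauchy sequence.
  have hcomp := isCompact_closure_of_isTightMeasureSet htight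
  obtain ⟨μ, -, k, hk, hlim⟩ := hcomp.tendsto_subseq fun n => subset_closure ⟨n, rfl⟩
  refine ⟨LevyProkhorov.ofMeasure μ, tendsto_nhds_of_cauchySeq_of_subseq hv hk.tendsto_atTop ?_⟩
  exact (LevyProkhorov.continuous_ofMeasure_probabilityMeasure.tendsto μ).comp hlim

theorem polishSpace_probabilityMeasure {X : Type*} [TopologicalSpace X] [PolishSpace X]
    [MeasurableSpace X] [BorelSpace X] : PolishSpace (ProbabilityMeasure X) := by
  have := separableSpace_probabilityMeasure (X := X)
  let := TopologicalSpace.upgradeIsCompletelyMetrizable X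
  have := completeSpace_levyProkhorov (X := X)
  let e := LevyProkhorov.probabilityMeasureHomeomorph (Ω := X)
  have : TopologicalSpace.IsCompletelyMetrizableSpace (ProbabilityMeasure X) :=
    e.isClosedEmbedding.IsCompletelyMetrizableSpace
  infer_instance

theorem polishSpace_borelProb (X : Type u) [TopologicalSpace X] [PolishSpace X] :
    PolishSpace (BorelProb X) := by
  borelize X
  exact polishSpace_probabilityMeasure

end PolishProbability

/-! ### The isomorphism with the Giry monad -/

section GiryIso

attribute [local instance] borel borelSpace_borel polishSpace_borelProb

variable (𝕜 : Type) [RCLike 𝕜] (X : Type u) [TopologicalSpace X] [PolishSpace X]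

/-- The homeomorphism between `P(X)` and the space of Borel probability measures. -/
noncomputable def ProbSpace.homeo : ProbSpace 𝕜 X ≃ₜ BorelProb X :=
  (exists_homeomorph_borelProb 𝕜 X).choose

variable {𝕜 X}

theorem ProbSpace.apply_eq_integral_homeo (φ : ProbSpace 𝕜 X) (f : Cb 𝕜 X) :
    φ f = ∫ x, f x ∂(ProbSpace.homeo 𝕜 X φ).toMeasure :=
  (exists_homeomorph_borelProb 𝕜 X).choose_spec φ f

theorem ProbSpace.lintegral_homeo (φ : ProbSpace 𝕜 X) (f : X →ᵇ NNReal) :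
    ∫⁻ x, f x ∂(ProbSpace.homeo 𝕜 X φ).toMeasure =
      ENNReal.ofReal (RCLike.re (φ (Cb.ofReal 𝕜 f.coeNNReal))) :=
  BorelProb.lintegral_eq_ofReal_apply φ.apply_eq_integral_homeo f

theorem ProbSpace.homeo_map {Y : Type u} [TopologicalSpace Y] [PolishSpace Y] (g : C(X, Y))
    (φ : ProbSpace 𝕜 X) :
    ProbSpace.homeo 𝕜 Y (ProbSpace.map 𝕜 g φ) = BorelProb.map g (ProbSpace.homeo 𝕜 X φ) := by
  refine BorelProb.ext_of_integral (𝕜 := 𝕜) fun f => ?_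
  rw [← ProbSpace.apply_eq_integral_homeo, ProbSpace.map_apply, ProbSpace.apply_eq_integral_homeo]
  exact (integral_map g.continuous.measurable.aemeasurable
    f.toMap.continuous.aestronglyMeasurable).symm

theorem ProbSpace.homeo_dirac (x : X) :
    ProbSpace.homeo 𝕜 X (ProbSpace.dirac 𝕜 x) = BorelProb.dirac x := by
  refine BorelProb.ext_of_integral (𝕜 := 𝕜) fun f => ?_
  rw [← ProbSpace.apply_eq_integral_homeo, ProbSpace.dirac_apply]
  exact (integral_dirac f x).symm

/-- For a test function `f`, the map `μ ↦ ∫ f dμ` is itself bounded and continuous, and pulled back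
along the homeomorphism it is evaluation at `f`. Both sides are thus `π` applied to the same
function. -/
theorem ProbSpace.homeo_join (π : ProbSpace 𝕜 (ProbSpace 𝕜 X)) :
    ProbSpace.homeo 𝕜 X (ProbSpace.join 𝕜 X π) =
      BorelProb.mean (ProbSpace.homeo 𝕜 (BorelProb X)
        (ProbSpace.map 𝕜 (ProbSpace.homeo 𝕜 X : C(ProbSpace 𝕜 X, BorelProb X)) π)) := by
  refine BorelProb.ext_of_lintegral fun f => ?_
  obtain ⟨F, hF⟩ := BorelProb.exists_boundedContinuous_lintegral f
  rw [BorelProb.lintegral_mean _ (measurable_coe_boundedContinuous f)]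
  rw [lintegral_congr fun μ => (hF μ).symm, ProbSpace.lintegral_homeo, ProbSpace.lintegral_homeo,
    ProbSpace.join_apply, ProbSpace.map_apply]
  -- What remains is equality of the two functions on `P(X)`; the values are nonnegative, so
  -- truncation by `ENNReal.ofReal` loses nothing.
  congr 3
  ext φ
  have h1 : 0 ≤ RCLike.re (φ (Cb.ofReal 𝕜 f.coeNNReal)) :=
    (RCLike.nonneg_iff.1 (φ.nonneg fun x => RCLike.ofReal_nonneg.2 (NNReal.coe_nonneg _))).1
  have h2 := (hF (ProbSpace.homeo 𝕜 X φ)).trans (φ.lintegral_homeo f)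
  have h3 := congrArg ENNReal.toReal h2
  rw [ENNReal.coe_toReal, ENNReal.toReal_ofReal h1] at h3
  rw [Cb.toBidual_apply, φ.apply_ofReal, ← h3]
  rfl

variable (𝕜) in
theorem polishSpace_probSpace (X : Type u) [TopologicalSpace X] [PolishSpace X] :
    PolishSpace (ProbSpace 𝕜 X) :=
  (ProbSpace.homeo 𝕜 X).isClosedEmbedding.polishSpace

variable (𝕜) in
theorem isPolish_probMonad_obj (X : HKTop.{u}) (hX : isPolish X) :
    isPolish ((probMonad 𝕜).obj X) :=
  have : PolishSpace X.obj := hX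
  polishSpace_probSpace 𝕜 X.obj

instance Pol.polishSpace (X : Pol.{u}) : PolishSpace X.obj.obj := X.property

variable (𝕜) in
/-- The homeomorphisms between spaces of functionals and spaces of measures form an isomorphism of
monads. -/
noncomputable def probMonadIsoGiryMonad :
    restrictMonad (probMonad.{u} 𝕜) isPolish (isPolish_probMonad_obj 𝕜) ≅
      giryMonad polishSpace_borelProb :=
  MonadIso.mk
    (NatIso.ofComponents
      (fun X =>
        { hom := ObjectProperty.homMk (ObjectProperty.homMk
            (TopCat.ofHom (ProbSpace.homeo 𝕜 X.obj.obj : C(_, _))))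
          inv := ObjectProperty.homMk (ObjectProperty.homMk
            (TopCat.ofHom ((ProbSpace.homeo 𝕜 X.obj.obj).symm : C(_, _))))
          hom_inv_id := by
            ext φ
            exact congrArg (fun ψ : ProbSpace 𝕜 X.obj.obj => ψ)
              ((ProbSpace.homeo 𝕜 X.obj.obj).symm_apply_apply φ)
          inv_hom_id := by
            ext μ
            exact (ProbSpace.homeo 𝕜 X.obj.obj).apply_symm_apply μ })
      fun {X Y} g => by
        ext φ
        exact ProbSpace.homeo_map g.hom.hom.hom φ)
    (fun X => by
      ext x
      exact ProbSpace.homeo_dirac x)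
    (fun X => by
      ext π
      exact ProbSpace.homeo_join π)

end GiryIso

theorem mainTheorem7 (𝕜 : Type) [RCLike 𝕜] :
    (∀ (X : Type u) [TopologicalSpace X] [PolishSpace X],
      baire X = borel X ∧
      (∀ μ : @VectorMeasure X (borel X) 𝕜 _ _,
        IsFiniteMeasure (@VectorMeasure.variation X (borel X) 𝕜 _ _ _ μ) → IsRadonMeasure μ) ∧
      (∀ μ : @VectorMeasure X (baire X) 𝕜 _ _,
        IsFiniteMeasure (@VectorMeasure.variation X (baire X) 𝕜 _ _ _ μ) → IsKRegular μ) ∧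
      (∃ e : ProbSpace 𝕜 X ≃ₜ BorelProb X,
        ∀ (φ : ProbSpace 𝕜 X) (f : Cb 𝕜 X), φ f = ∫ x, f x ∂(e φ).toMeasure) ∧
      PolishSpace (ProbSpace 𝕜 X)) ∧
    ∃ (hP : ∀ X : HKTop.{u}, isPolish X → isPolish ((probMonad 𝕜).obj X))
      (hG : ∀ (X : Type u) [TopologicalSpace X] [PolishSpace X], PolishSpace (BorelProb X))
      (e : restrictMonad (probMonad.{u} 𝕜) isPolish hP ≅ giryMonad hG),
      ∀ (X : Pol.{u}) (φ : ProbSpace 𝕜 X.obj.obj) (f : Cb 𝕜 X.obj.obj),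
        φ f = ∫ x, f x ∂(BorelProb.toMeasure (e.hom.app X φ)) := by
  refine ⟨fun X _ _ => ⟨baire_eq_borel X, isRadonMeasure_of_polishSpace,
    isKRegular_of_polishSpace, exists_homeomorph_borelProb 𝕜 X, polishSpace_probSpace 𝕜 X⟩,
    isPolish_probMonad_obj 𝕜, polishSpace_borelProb, probMonadIsoGiryMonad 𝕜, fun X φ f => ?_⟩
  exact φ.apply_eq_integral_homeo f
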